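/- Let $r,s$ be integers with $1\le r\le s$, let $p$ be a prime, and let $F$ be a field of characteristic $p$. Write $[r]=\{1,\dots,r\}$. Let $J_\ell$ denote the $\ell\times\ell$ unipotent Jordan block (ones on the diagonal and on the first superdiagonal, zeros elsewhere). The Jordan canonical form of $J_r\otimes J_s$ over $F$ has exactly $r$ blocks, so it is $J_{\lambda_1}\oplus\cdots\oplus J_{\lambda_r}$ for a unique sequence $\lambda=\lambda(r,s,p)=(\lambda_1,\dots,\lambda_r)$ of integers with $\lambda_1\ge\cdots\ge\lambda_r>0$. Put $\varepsilon=(\lambda_1-s,\dots,\lambda_r-s)$ (the deviation vector). For $0\le n\le r$ let $D_n(r,s)$ be the determinant of the $n\times n$ matrix with $(i,j)$-entry $\binom{s+r-2n}{s-n+i-j}$, $0\le i,j\le n-1$, where $\binom{a}{k}=0$ for $k<0$ and $D_0(r,s)=1$. Let $\delta_n=0$ if $D_n(r,s)\equiv 0\pmod p$, and $\delta_n=1$ otherwise; one has $\delta_0=\delta_r=1$. For $n\in[r]$ let $L(n)$ be the smallest positive integer with $\delta_{n-L(n)}=1$, and $R(n)$ the smallest nonnegative integer with $\delta_{n+R(n)}=1$.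 Let $T=\{i\in[r-1]\mid\delta_i=1\}=\{t_1<\dots<t_{|T|}\}$, $t_0=0$, $t_{|T|+1}=r$. Let $\mathcal E$ be the set of all $e=(e_1,\dots,e_r)\in\mathbb Z^r$ with $e_1\ge\cdots\ge e_r$, with $e_i-e_j\ne j-i$ for $1\le i<j\le r$, and with $1-n\le e_n\le r-n$ for $n\in[r]$. Let $\Phi_{\mathcal E\mathcal T}$ be the map from $\mathcal E$ to the set of subsets of $[r-1]$ given by $e\mapsto\{t\in[r-1]\mid e_t>e_{t+1}\}$. For $1\le i\le j\le r$, let $\mathrm{Rev}(i,j)$ be the permutation of $[r]$ with $n\mapsto i+j-n$ for $i\le n\le j$ and $n\mapsto n$ otherwise. Then: (a) $\Phi_{\mathcal E\mathcal T}$ is a bijection, $\varepsilon\in\mathcal E$, and $\varepsilon=\Phi_{\mathcal E\mathcal T}^{-1}(T)$. (b) $\lambda$ is a partition of $rs$, the map $\pi=\pi(r,s,p)$ given by $n^{\pi}=(r+1-n)+s-\lambda_n$ is a permutation of $[r]$, and $$\pi(r,s,p)=\prod_{i=0}^{|T|}\mathrm{Rev}(t_i+1,t_{i+1}).$$ (c)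 $n^{\pi(r,s,p)}=n+1-L(n)+R(n)$ for each $n\in[r]$. (d) $\lambda_n=r+s-2n+L(n)-R(n)$ for each $n\in[r]$. In particular, $\lambda$ depends only on $r$, $s$ and $p$, and not on $F$. -/

import Mathlib

namespace Norman

/-- The set `[r] = {1, ..., r}`, as a type. -/
abbrev Idx (r : ℕ) : Type := {n : ℕ // n ∈ Finset.Icc 1 r}

/-! ### Jordan partitions -/

/-- The nilpotent Jordan block `N_l`: ones on the first superdiagonal, zeros elsewhere. -/
def nilBlock (F : Type*) [Field F] (l : ℕ) : Matrix (Fin l) (Fin l) F :=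
  Matrix.of fun i j => if (i : ℕ) + 1 = (j : ℕ) then 1 else 0

/-- The unipotent Jordan block `J_l = I_l + N_l`. -/
def jordanBlock (F : Type*) [Field F] (l : ℕ) : Matrix (Fin l) (Fin l) F :=
  1 + nilBlock F l

/-- The block diagonal matrix `J_{lam_1} ⊕ ... ⊕ J_{lam_k}`. -/
def jordanSum (F : Type*) [Field F] {k : ℕ} (lam : Idx k → ℕ) :
    Matrix ((n : Idx k) × Fin (lam n)) ((n : Idx k) × Fin (lam n)) F :=
  Matrix.blockDiagonal' fun n => jordanBlock F (lam n)

/-- Similarity of square matrices (their index types may be different): `A = P B P⁻¹`,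
where `Q = P⁻¹`. -/
def Similar {F : Type*} [Field F] {m n : Type*} [Fintype m] [Fintype n] [DecidableEq m]
    [DecidableEq n] (A : Matrix m m F) (B : Matrix n n F) : Prop :=
  ∃ (P : Matrix m n F) (Q : Matrix n m F), P * Q = 1 ∧ Q * P = 1 ∧ A = P * B * Q

/-- `lam = (lam_1 ≥ ... ≥ lam_r > 0)` is the Jordan partition of `J_r ⊗ J_s` over `F`, that is,
the Jordan canonical form of `J_r ⊗ J_s` is `J_{lam_1} ⊕ ... ⊕ J_{lam_r}`. -/
def IsJordanPartition (F : Type*) [Field F] (r s : ℕ) (lam : Idx r → ℕ) : Prop :=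
  (∀ i j : Idx r, (i : ℕ) ≤ j → lam j ≤ lam i) ∧ (∀ n, 0 < lam n) ∧
    Similar (Matrix.kronecker (jordanBlock F r) (jordanBlock F s)) (jordanSum F lam)

/-! ### Subsets of `[r-1]`, `r`-tuples, and permutations of `[r]` -/

/-- The set of all subsets of `[r-1] = {1, ..., r-1}`. -/
abbrev Subsets (r : ℕ) : Type := {T : Finset ℕ // T ⊆ Finset.Icc 1 (r - 1)}

/-- The `r`-tuples of integers `eps_1 ≥ ... ≥ eps_r` such that `eps_i - eps_j ≠ j - i`
for `i < j` and `1 - n ≤ eps_n ≤ r - n` for all `n`. -/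
def IsDeviationTuple {r : ℕ} (eps : Idx r → ℤ) : Prop :=
  (∀ i j : Idx r, (i : ℕ) ≤ j → eps j ≤ eps i) ∧
  (∀ i j : Idx r, (i : ℕ) < j → eps i - eps j ≠ ((j : ℕ) : ℤ) - ((i : ℕ) : ℤ)) ∧
  (∀ n : Idx r, 1 - ((n : ℕ) : ℤ) ≤ eps n ∧ eps n ≤ (r : ℤ) - ((n : ℕ) : ℤ))

/-- The set `E` of all `r`-tuples as in `IsDeviationTuple`. -/
abbrev Tuples (r : ℕ) : Type := {eps : Idx r → ℤ // IsDeviationTuple eps}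

open Classical in
/-- The map `E → T`, `eps ↦ {t ∈ [r-1] | eps_t > eps_{t+1}}`. -/
noncomputable def descents {r : ℕ} (eps : Tuples r) : Subsets r :=
  ⟨(Finset.Icc 1 (r - 1)).filter fun t =>
      ∃ i j : Idx r, (i : ℕ) = t ∧ (j : ℕ) = t + 1 ∧ eps.1 i > eps.1 j,
    Finset.filter_subset _ _⟩

/-- The underlying map of the reversal `Rev(i, j)`: `n ↦ i + j - n` if `i ≤ n ≤ j`, and `n ↦ n`
otherwise. (If `1 ≤ i ≤ j ≤ r`, then the third condition follows from the first two.) -/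
def revFun (r i j : ℕ) (n : Idx r) : Idx r :=
  if h : i ≤ n.1 ∧ n.1 ≤ j ∧ i + j - n.1 ∈ Finset.Icc 1 r then ⟨i + j - n.1, h.2.2⟩ else n

theorem revFun_involutive (r i j : ℕ) : Function.Involutive (revFun r i j) := by
  rintro ⟨n, hn⟩
  by_cases h : i ≤ n ∧ n ≤ j ∧ i + j - n ∈ Finset.Icc 1 r
  · have e : i + j - (i + j - n) = n := by omega
    have h1 : revFun r i j ⟨n, hn⟩ = ⟨i + j - n, h.2.2⟩ := dif_pos h
    have h2 : i ≤ i + j - n ∧ i + j - n ≤ j ∧ i + j - (i + j - n) ∈ Finset.Icc 1 r :=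
      ⟨by omega, by omega, by rwa [e]⟩
    rw [h1]
    unfold revFun
    rw [dif_pos h2]
    exact Subtype.ext e
  · have h1 : revFun r i j ⟨n, hn⟩ = ⟨n, hn⟩ := dif_neg h
    rw [h1, h1]

/-- The reversal permutation `Rev(i, j)` of `[r]`, for `1 ≤ i ≤ j ≤ r`. -/
def Rev (r i j : ℕ) : Equiv.Perm (Idx r) := (revFun_involutive r i j).toPerm

/-- The `i`-th term of the sequence `0 = t_0 < t_1 < ... < t_{|T|} < t_{|T|+1} = r`, where
`T = {t_1 < ... < t_{|T|}}`. -/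
def breakpoint {r : ℕ} (T : Subsets r) (i : ℕ) : ℕ :=
  if i = 0 then 0 else (T.1.sort (· ≤ ·)).getD (i - 1) r

/-- The product `pi_T` of the reversals `Rev(t_i + 1, t_{i+1})`, `0 ≤ i ≤ |T|`. -/
def permOfSubset {r : ℕ} (T : Subsets r) : Equiv.Perm (Idx r) :=
  (List.ofFn fun i : Fin (T.1.card + 1) =>
    Rev r (breakpoint T (i : ℕ) + 1) (breakpoint T ((i : ℕ) + 1))).prod

/-- The deviation vector `(lam_1 - s, ..., lam_r - s)`. -/
def deviation {r : ℕ} (s : ℕ) (lam : Idx r → ℕ) : Idx r → ℤ := fun n => (lam n : ℤ) - (s : ℤ)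

/-- `lam` is a partition of `r * s` with parts `lam_1 ≥ ... ≥ lam_r > 0` such that
`lam_i - lam_j ≠ j - i` for `i < j` and `1 - n ≤ lam_n - s ≤ r - n` for all `n`. -/
structure IsNormanPartition {r : ℕ} (s : ℕ) (lam : Idx r → ℕ) : Prop where
  anti : ∀ i j : Idx r, (i : ℕ) ≤ j → lam j ≤ lam i
  pos : ∀ n, 0 < lam n
  sum_eq : ∑ n, lam n = r * s
  sub_ne : ∀ i j : Idx r, (i : ℕ) < j →
    (lam i : ℤ) - (lam j : ℤ) ≠ ((j : ℕ) : ℤ) - ((i : ℕ) : ℤ)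
  bounds : ∀ n : Idx r, 1 - ((n : ℕ) : ℤ) ≤ (lam n : ℤ) - (s : ℤ) ∧
    (lam n : ℤ) - (s : ℤ) ≤ (r : ℤ) - ((n : ℕ) : ℤ)

/-- The map `n ↦ (r + 1 - n) + s - lam_n` from `[r]` to `[r]`. -/
def normanFun {r s : ℕ} {lam : Idx r → ℕ} (h : IsNormanPartition s lam) (n : Idx r) : Idx r :=
  ⟨((r : ℤ) + 1 - ((n : ℕ) : ℤ) + (s : ℤ) - (lam n : ℤ)).toNat, by
    have := h.bounds n
    rw [Finset.mem_Icc]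
    omega⟩

theorem coe_normanFun {r s : ℕ} {lam : Idx r → ℕ} (h : IsNormanPartition s lam) (n : Idx r) :
    (((normanFun h n : Idx r) : ℕ) : ℤ) =
      ((r : ℤ) + 1 - ((n : ℕ) : ℤ)) + (s : ℤ) - (lam n : ℤ) := by
  have := h.bounds n
  unfold normanFun
  dsimp only
  omega

theorem normanFun_bijective {r s : ℕ} {lam : Idx r → ℕ} (h : IsNormanPartition s lam) :
    Function.Bijective (normanFun h) := by
  refine Finite.injective_iff_bijective.mp fun i j hij => ?_
  have hi := coe_normanFun h i
  have hj := coe_normanFun h j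
  rw [hij] at hi
  rcases lt_trichotomy (i : ℕ) (j : ℕ) with hlt | heq | hgt
  · have := h.sub_ne i j hlt
    omega
  · exact Subtype.ext heq
  · have := h.sub_ne j i hgt
    omega

/-- The Norman permutation of `[r]`, mapping `n` to `(r + 1 - n) + s - lam_n`. -/
noncomputable def normanPerm {r s : ℕ} {lam : Idx r → ℕ} (h : IsNormanPartition s lam) :
    Equiv.Perm (Idx r) :=
  Equiv.ofBijective (normanFun h) (normanFun_bijective h)

/-! ### The determinants `D_n(r, s)` and the functions `L` and `R` -/

/-- The binomial coefficient `a choose k` for an integer `k`; it is `0` for `k < 0`. -/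
def chooseInt (a : ℕ) (k : ℤ) : ℤ := if 0 ≤ k then (a.choose k.toNat : ℤ) else 0

/-- `D_n(r, s)`, the determinant of the `n × n` matrix with `(i, j)`-entry
`(s + r - 2n) choose (s - n + i - j)`, `0 ≤ i, j ≤ n - 1`, for `0 ≤ n ≤ r ≤ s`; it is `1` for
`n = 0`. -/
def D (r s n : ℕ) : ℤ :=
  Matrix.det (Matrix.of fun i j : Fin n =>
    chooseInt (s + r - 2 * n) ((s : ℤ) - (n : ℤ) + ((i : ℕ) : ℤ) - ((j : ℕ) : ℤ)))

/-- `delta_n` is `0` if `D_n(r, s) ≡ 0 (mod p)`, and `1` otherwise. -/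
def delta (r s p n : ℕ) : ℕ := if D r s n ≡ 0 [ZMOD (p : ℤ)] then 0 else 1

/-- `L(n)` is the smallest positive integer `l` such that `delta_{n-l} = 1`. -/
noncomputable def L (r s p n : ℕ) : ℕ := sInf {l | 0 < l ∧ l ≤ n ∧ delta r s p (n - l) = 1}

/-- `R(n)` is the smallest nonnegative integer `k` such that `delta_{n+k} = 1`. -/
noncomputable def R (r s p n : ℕ) : ℕ := sInf {k | n + k ≤ r ∧ delta r s p (n + k) = 1}

/-- The set `T = {i ∈ [r-1] | delta_i = 1}`. -/
def nonvanishing (r s p : ℕ) : Subsets r :=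
  ⟨(Finset.Icc 1 (r - 1)).filter fun i => delta r s p i = 1, Finset.filter_subset _ _⟩

end Norman

/-!
The unipotent matrix `J_r ⊗ J_s` is multiplication by `(1 + x)(1 + y)` on `F[x, y] / (x^r, y^s)`.
Replacing `x (1 + y)` by `x` turns its nilpotent part into multiplication by `x + y`
(`similar_kronecker_sub_one`), which is homogeneous. Hence the rank of the `k`-th power is the sum of
the ranks of the Toeplitz matrices of `(x + y)^k` in the single degrees (`rank_nilSum_pow`).

Put `m = r + s - k`, and let `c n` be the rank of `(x + y)^k` from degree `n - 1` to degree
`n - 1 + k`. The kernels of `(x + y)^k` form an ideal, which forces `c` to stop growing as soon as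
`c n < n` (`finrank_powKer_lt_succ`), and the Toeplitz matrices for `n` and for `m - n` are transposes
of each other up to the order of rows and columns (`rank_toeplitz_symm`). So `c n` is the minimum of
`n`, `a m` and `m - n` for some `a m ≤ m / 2` (`exists_trapezoid`), and the rank of the `k`-th power is
`a m * (m - a m)`. For `m = 2n` the Toeplitz matrix in the middle has determinant `D_n`, whence
`D_n ≢ 0` if and only if `a (2n) = n` (`exists_walk`).

Both `a` and `m - a` can only grow, so `m - 2 * a m` is a walk with steps `±1` which touches `0` at
`2n` exactly when `D_n ≢ 0`. The number of Jordan blocks of size at least `r + s - m` is the increment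
of `a m * (m - a m)`, which is `a m` where the walk goes up and `m - a m` where it goes down. As this
number is monotone in `m`, the walk cannot turn from down to up away from `0`; between two consecutive
zeros `2t < 2t'` it is therefore a single peak, and `lam_n = r + s - t - t'` for `t < n ≤ t'`
(`part_eq_of_walk`). A Jordan normal form exists by the structure theorem for modules over `F[X]`
(`exists_similar_jordanSum`), and the rank of the first power shows that it has `r` blocks.

The remaining claims are combinatorics of such piecewise constant tuples. Given a deviation tuple
`eps`, the permutation `n ↦ r + 1 - n - eps_n` descends only by steps of `1`, and so `[t]` is invariant
for every descent `t` of `eps` (`image_bounds_of_descent`). This makes `eps` equal to `r - t - t'`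
between consecutive descents `t < t'` (`eq_sub_of_isGap_descents`), where the permutation is
`n ↦ t + t' + 1 - n`, a reversal.
-/

namespace Norman

/-! ### Gaps of a subset of `[r-1]` -/

/-- `t < t'` are consecutive terms of the sequence `0 = t_0 < t_1 < ... < t_{|T|} < t_{|T|+1} = r`,
where `T = {t_1 < ... < t_{|T|}}`. -/
structure IsGap (r : ℕ) (T : Finset ℕ) (t t' : ℕ) : Prop where
  left : t = 0 ∨ t ∈ T
  right : t' = r ∨ t' ∈ T
  lt : t < t'
  not_between : ∀ u ∈ T, u ≤ t ∨ t' ≤ u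

theorem IsGap.le {r : ℕ} {T : Finset ℕ} (hT : T ⊆ Finset.Icc 1 (r - 1)) {t t' : ℕ}
    (h : IsGap r T t t') : t' ≤ r := by
  rcases h.right with h | h
  · exact h.le
  · have := Finset.mem_Icc.1 (hT h)
    omega

theorem exists_isGap {r : ℕ} {T : Finset ℕ} {n : ℕ} (h1 : 1 ≤ n)
    (hr : n ≤ r) : ∃ t t', IsGap r T t t' ∧ t < n ∧ n ≤ t' := by
  have hA : ((insert 0 T).filter (· < n)).Nonempty := ⟨0, by simp; omega⟩
  have hB : ((insert r T).filter (n ≤ ·)).Nonempty := ⟨r, by simp; omega⟩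
  have ha := Finset.mem_filter.1 (Finset.max'_mem _ hA)
  have hb := Finset.mem_filter.1 (Finset.min'_mem _ hB)
  refine ⟨_, _, ⟨Finset.mem_insert.1 ha.1, Finset.mem_insert.1 hb.1, ha.2.trans_le hb.2, ?_⟩,
    ha.2, hb.2⟩
  intro u hu
  rcases lt_or_ge u n with h | h
  · exact Or.inl (Finset.le_max' _ _ (by simp [hu, h]))
  · exact Or.inr (Finset.min'_le _ _ (by simp [hu, h]))

/-- Two gaps either coincide or do not overlap. -/
theorem IsGap.eq_or_le {r : ℕ} {T : Finset ℕ} (hT : T ⊆ Finset.Icc 1 (r - 1)) {t t' u u' i j : ℕ}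
    (h : IsGap r T t t') (h' : IsGap r T u u') (hi : t < i) (hi' : i ≤ t') (hj : u < j)
    (hj' : j ≤ u') (hij : i ≤ j) : (t = u ∧ t' = u') ∨ t' ≤ u := by
  have l1 := h.le hT
  have l2 := h'.le hT
  have a1 := h.not_between
  have a2 := h'.not_between
  rcases h.left with e1 | e1 <;> rcases h.right with e2 | e2 <;> rcases h'.left with e3 | e3 <;>
    rcases h'.right with e4 | e4
  all_goals
    try have b1 := a2 _ e1
    try have b2 := a2 _ e2
    try have b3 := a1 _ e3
    try have b4 := a1 _ e4
    omega

/-! ### Deviation tuples and subsets -/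

/-- `r + 1 - n - eps_n`, the value at `n` of the permutation attached to a deviation tuple, is
injective in `n`. -/
theorem IsDeviationTuple.image_injOn {r : ℕ} {eps : Idx r → ℤ} (h : IsDeviationTuple eps)
    {i j : Idx r} (hij : ((i : ℕ) : ℤ) + eps i = ((j : ℕ) : ℤ) + eps j) : i = j := by
  rcases lt_trichotomy (i : ℕ) j with hlt | heq | hgt
  · have := h.2.1 i j hlt
    omega
  · exact Subtype.ext heq
  · have := h.2.1 j i hgt
    omega

/-- A strict drop of `eps` between `i` and `j` forces the permutation `n ↦ r + 1 - n - eps_n` to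
increase from `i` to `j`: it can go down only by steps of `1`, along which `eps` is constant, so
it cannot cross a value which it has already taken. -/
theorem IsDeviationTuple.add_lt_add {r : ℕ} {eps : Idx r → ℤ} (h : IsDeviationTuple eps)
    (i : Idx r) (j : ℕ) (hj : j ∈ Finset.Icc 1 r) (hij : (i : ℕ) < j) (he : eps ⟨j, hj⟩ < eps i) :
    (j : ℤ) + eps ⟨j, hj⟩ < ((i : ℕ) : ℤ) + eps i := by
  induction j with
  | zero => omega
  | succ m ih =>
    have hm : m ∈ Finset.Icc 1 r := by
      have := Finset.mem_Icc.1 i.2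
      simp only [Finset.mem_Icc] at hj ⊢
      omega
    have h1 : eps ⟨m + 1, hj⟩ ≤ eps ⟨m, hm⟩ := h.1 _ _ (Nat.le_succ m)
    have him : (i : ℕ) ≤ m := by omega
    have h2 : eps ⟨m, hm⟩ ≤ eps i := h.1 _ _ him
    rcases h2.lt_or_eq with h2 | h2
    · have him' : (i : ℕ) < m := by
        rcases him.lt_or_eq with h3 | h3
        · exact h3
        · have : i = ⟨m, hm⟩ := Subtype.ext h3
          rw [this] at h2
          omega
      have h3 := ih hm him' h2
      have h4 : ((i : ℕ) : ℤ) + eps i ≠ ((m + 1 : ℕ) : ℤ) + eps ⟨m + 1, hj⟩ := fun e => by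
        have := congrArg Subtype.val (h.image_injOn (j := ⟨m + 1, hj⟩) e)
        simp only at this
        omega
      push_cast at h4 ⊢
      omega
    · -- `eps` is constant from `i` to `m`, so every value from the one at `m` to the one at `i`
      -- has been taken
      by_contra hlt
      push Not at hlt
      obtain ⟨q, hq⟩ : ∃ q : ℕ, (q : ℤ) + eps i = ((m + 1 : ℕ) : ℤ) + eps ⟨m + 1, hj⟩ :=
        ⟨((m + 1 : ℕ) + eps ⟨m + 1, hj⟩ - eps i).toNat, by push_cast at hlt ⊢; omega⟩
      have hiq : (i : ℕ) ≤ q := by omega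
      have hqm : q ≤ m := by push_cast at hq; omega
      have hqr : q ∈ Finset.Icc 1 r := by
        have := Finset.mem_Icc.1 i.2
        simp only [Finset.mem_Icc] at hm ⊢
        omega
      have e1 : eps ⟨q, hqr⟩ ≤ eps i := h.1 _ _ hiq
      have e2 : eps ⟨m, hm⟩ ≤ eps ⟨q, hqr⟩ := h.1 _ _ hqm
      have e3 : eps ⟨q, hqr⟩ = eps i := le_antisymm e1 (h2 ▸ e2)
      have := congrArg Subtype.val
        (h.image_injOn (i := ⟨q, hqr⟩) (j := ⟨m + 1, hj⟩) (by rw [e3]; exact hq))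
      simp only at this
      omega

theorem mem_descents {r : ℕ} (eps : Tuples r) (t : ℕ) (ht : t ∈ Finset.Icc 1 r)
    (ht' : t + 1 ∈ Finset.Icc 1 r) :
    t ∈ (descents eps).1 ↔ eps.1 ⟨t + 1, ht'⟩ < eps.1 ⟨t, ht⟩ := by
  unfold descents
  simp only [Finset.mem_filter]
  constructor
  · rintro ⟨-, ⟨i, hi⟩, ⟨j, hj⟩, rfl, e, h⟩
    simp only at e
    subst e
    exact h
  · intro h
    refine ⟨?_, ⟨t, ht⟩, ⟨t + 1, ht'⟩, rfl, rfl, h⟩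
    simp only [Finset.mem_Icc] at ht ht' ⊢
    omega

/-- A deviation tuple is constant on each gap of its set of descents. -/
theorem eq_of_isGap_descents {r : ℕ} (eps : Tuples r) {t t' : ℕ}
    (hg : IsGap r (descents eps).1 t t') (i : Idx r) (hi : t < i) (d : ℕ)
    (hd : (i : ℕ) + d ≤ t') (h : (i : ℕ) + d ∈ Finset.Icc 1 r) : eps.1 ⟨i + d, h⟩ = eps.1 i := by
  induction d with
  | zero => rfl
  | succ d ih =>
    have h0 : (i : ℕ) + d ∈ Finset.Icc 1 r := by
      simp only [Finset.mem_Icc] at h ⊢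
      omega
    rw [← ih (by omega) h0]
    refine le_antisymm (eps.2.1 _ _ (by simp)) ?_
    by_contra hlt
    push Not at hlt
    have := hg.not_between _ ((mem_descents eps (i + d) h0 h).2 hlt)
    omega

theorem card_filter_coe_le {r q : ℕ} (hq : q ≤ r) :
    (Finset.univ.filter fun a : Idx r => (a : ℕ) ≤ q).card = q := by
  rw [← Finset.card_map (Function.Embedding.subtype _)]
  trans (Finset.Icc 1 q).card
  · congr 1
    ext x
    simp only [Finset.mem_map, Finset.mem_filter, Finset.mem_univ, true_and,
      Function.Embedding.coe_subtype, Finset.mem_Icc]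
    constructor
    · rintro ⟨a, ha, rfl⟩
      exact ⟨(Finset.mem_Icc.1 a.2).1, ha⟩
    · intro hx
      exact ⟨⟨x, Finset.mem_Icc.2 (by omega)⟩, hx.2, rfl⟩
  · simp

/-- The permutation `n ↦ r + 1 - n - eps_n` maps `[t]` to itself for every descent `t` of `eps`,
since there it takes larger values after `t` than up to `t`. -/
theorem image_bounds_of_descent {r : ℕ} (eps : Tuples r) {t : ℕ}
    (ht : t = 0 ∨ t = r ∨ t ∈ (descents eps).1) (i : Idx r) :
    ((i : ℕ) ≤ t → (r : ℤ) + 1 - (i : ℕ) - eps.1 i ≤ t) ∧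
      (t < (i : ℕ) → (t : ℤ) < (r : ℤ) + 1 - (i : ℕ) - eps.1 i) := by
  have hbd := eps.2.2.2
  have hi := Finset.mem_Icc.1 i.2
  rcases ht with rfl | rfl | ht
  · have := hbd i
    omega
  · have := hbd i
    omega
  have htr : t ∈ Finset.Icc 1 (r - 1) := (descents eps).2 ht
  rw [Finset.mem_Icc] at htr
  have m1 : t ∈ Finset.Icc 1 r := by rw [Finset.mem_Icc]; omega
  have m2 : t + 1 ∈ Finset.Icc 1 r := by rw [Finset.mem_Icc]; omega
  have hdrop := (mem_descents eps t m1 m2).1 ht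
  have key : ∀ a b : Idx r, (a : ℕ) ≤ t → t < (b : ℕ) →
      ((b : ℕ) : ℤ) + eps.1 b < ((a : ℕ) : ℤ) + eps.1 a := by
    intro a b ha hb
    refine eps.2.add_lt_add a b b.2 (by omega) ?_
    have e1 : eps.1 ⟨t, m1⟩ ≤ eps.1 a := eps.2.1 _ _ ha
    have e2 : eps.1 b ≤ eps.1 ⟨t + 1, m2⟩ := eps.2.1 _ _ hb
    exact e2.trans_lt (hdrop.trans_le e1)
  set f : Idx r → ℤ := fun n => (r : ℤ) + 1 - (n : ℕ) - eps.1 n with hf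
  have finj : Function.Injective f := fun a b hab => eps.2.image_injOn (by
    simp only [hf] at hab
    omega)
  have hlow := card_filter_coe_le (r := r) (q := t) (by omega)
  have hall : (Finset.univ : Finset (Idx r)).card = r := by
    rw [Finset.card_univ, Fintype.card_coe]
    simp
  have hhigh : (Finset.univ.filter fun a : Idx r => t < (a : ℕ)).card = r - t := by
    have := Finset.card_filter_add_card_filter_not (s := (Finset.univ : Finset (Idx r)))
      (fun a : Idx r => (a : ℕ) ≤ t)
    simp only [not_le] at this
    omega
  constructor
  · intro hit
    have := Finset.card_le_card_of_injOn (s := Finset.univ.filter fun a : Idx r => t < (a : ℕ))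
      (t := Finset.Ioc (f i) r) f (by
        intro b hb
        simp only [Finset.coe_filter, Finset.mem_univ, true_and, Set.mem_ofPred_eq] at hb
        have := key i b hit hb
        have := hbd b
        simp only [hf, Finset.coe_Ioc, Set.mem_Ioc]
        omega) finj.injOn
    rw [hhigh, Int.card_Ioc] at this
    change f i ≤ t
    omega
  · intro hit
    have := Finset.card_le_card_of_injOn (s := Finset.univ.filter fun a : Idx r => (a : ℕ) ≤ t)
      (t := Finset.Ico 1 (f i)) f (by
        intro b hb
        simp only [Finset.coe_filter, Finset.mem_univ, true_and, Set.mem_ofPred_eq] at hb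
        have := key b i hb hit
        have := hbd b
        simp only [hf, Finset.coe_Ico, Set.mem_Ico]
        omega) finj.injOn
    rw [hlow, Int.card_Ico] at this
    change (t : ℤ) < f i
    omega

/-- A deviation tuple is determined by its set of descents: on the gap from `t` to `t'` it has the
value `r - t - t'`. -/
theorem eq_sub_of_isGap_descents {r : ℕ} (eps : Tuples r) {t t' : ℕ}
    (hg : IsGap r (descents eps).1 t t') (n : Idx r) (hn : t < n) (hn' : (n : ℕ) ≤ t') :
    eps.1 n = (r : ℤ) - t - t' := by
  have hlt := hg.lt
  have hle := hg.le (descents eps).2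
  have m1 : t + 1 ∈ Finset.Icc 1 r := by rw [Finset.mem_Icc]; omega
  have m2 : t' ∈ Finset.Icc 1 r := by rw [Finset.mem_Icc]; omega
  have hc : ∀ m : Idx r, t < m → (m : ℕ) ≤ t' → eps.1 m = eps.1 ⟨t + 1, m1⟩ := by
    rintro ⟨m, hm⟩ h1 h2
    obtain ⟨d, rfl⟩ := Nat.exists_eq_add_of_le (show t + 1 ≤ m from h1)
    exact eq_of_isGap_descents eps hg ⟨t + 1, m1⟩ (by simp) d h2 hm
  have e1 := hc n hn hn'
  have e2 := hc ⟨t', m2⟩ hlt le_rfl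
  have b1 := (image_bounds_of_descent eps (hg.right.elim (fun h => .inr (.inl h))
    (fun h => .inr (.inr h))) ⟨t + 1, m1⟩).1 hlt
  have b2 := (image_bounds_of_descent eps (hg.left.elim .inl (fun h => .inr (.inr h)))
    ⟨t', m2⟩).2 hlt
  simp only at b1 b2
  push_cast at b1 b2
  omega

/-- Conversely, the tuple with value `r - t - t'` on every gap from `t` to `t'` of `T` is a
deviation tuple. -/
theorem isDeviationTuple_of_isGap {r : ℕ} (T : Subsets r) {eps : Idx r → ℤ}
    (h : ∀ (n : Idx r) (t t' : ℕ), IsGap r T.1 t t' → t < n → (n : ℕ) ≤ t' →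
      eps n = (r : ℤ) - t - t') : IsDeviationTuple eps := by
  refine ⟨fun i j hij => ?_, fun i j hij => ?_, fun n => ?_⟩
  · obtain ⟨t, t', hg, h1, h2⟩ := exists_isGap (T := T.1) (Finset.mem_Icc.1 i.2).1
      (Finset.mem_Icc.1 i.2).2
    obtain ⟨u, u', hg', h1', h2'⟩ := exists_isGap (T := T.1) (Finset.mem_Icc.1 j.2).1
      (Finset.mem_Icc.1 j.2).2
    have := hg.eq_or_le T.2 hg' h1 h2 h1' h2' hij
    rw [h i t t' hg h1 h2, h j u u' hg' h1' h2']
    omega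
  · obtain ⟨t, t', hg, h1, h2⟩ := exists_isGap (T := T.1) (Finset.mem_Icc.1 i.2).1
      (Finset.mem_Icc.1 i.2).2
    obtain ⟨u, u', hg', h1', h2'⟩ := exists_isGap (T := T.1) (Finset.mem_Icc.1 j.2).1
      (Finset.mem_Icc.1 j.2).2
    have := hg.eq_or_le T.2 hg' h1 h2 h1' h2' hij.le
    rw [h i t t' hg h1 h2, h j u u' hg' h1' h2']
    omega
  · obtain ⟨t, t', hg, h1, h2⟩ := exists_isGap (T := T.1) (Finset.mem_Icc.1 n.2).1
      (Finset.mem_Icc.1 n.2).2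
    rw [h n t t' hg h1 h2]
    have := hg.le T.2
    omega

theorem descents_of_isGap {r : ℕ} (T : Subsets r) (eps : Tuples r)
    (h : ∀ (n : Idx r) (t t' : ℕ), IsGap r T.1 t t' → t < n → (n : ℕ) ≤ t' →
      eps.1 n = (r : ℤ) - t - t') : descents eps = T := by
  apply Subtype.ext
  ext x
  by_cases hx : x ∈ Finset.Icc 1 (r - 1)
  swap
  · exact ⟨fun h => absurd ((descents eps).2 h) hx, fun h => absurd (T.2 h) hx⟩
  rw [Finset.mem_Icc] at hx
  have m1 : x ∈ Finset.Icc 1 r := by rw [Finset.mem_Icc]; omega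
  have m2 : x + 1 ∈ Finset.Icc 1 r := by rw [Finset.mem_Icc]; omega
  rw [mem_descents eps x m1 m2]
  obtain ⟨t, t', hg, h1, h2⟩ := exists_isGap (T := T.1) (n := x) (r := r) (by omega) (by omega)
  obtain ⟨u, u', hg', h1', h2'⟩ := exists_isGap (T := T.1) (n := x + 1) (r := r)
    (by omega) (by omega)
  have e := hg.eq_or_le T.2 hg' h1 h2 h1' h2' (Nat.le_succ x)
  rw [h ⟨x, m1⟩ t t' hg h1 h2, h ⟨x + 1, m2⟩ u u' hg' h1' h2']
  have := hg.lt
  have := hg'.lt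
  constructor
  · intro hlt
    have hxt : x = t' := by omega
    rcases hg.right with e1 | e1
    · omega
    · exact hxt ▸ e1
  · intro hxT
    have := hg.not_between x hxT
    have := hg'.not_between x hxT
    omega

theorem exists_tuple_of_isGap {r : ℕ} (T : Subsets r) :
    ∃ eps : Idx r → ℤ, ∀ (n : Idx r) (t t' : ℕ), IsGap r T.1 t t' → t < n → (n : ℕ) ≤ t' →
      eps n = (r : ℤ) - t - t' := by
  have hex : ∀ n : Idx r, ∃ q : ℕ × ℕ, IsGap r T.1 q.1 q.2 ∧ q.1 < n ∧ (n : ℕ) ≤ q.2 := by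
    intro n
    obtain ⟨t, t', h⟩ := exists_isGap (T := T.1) (Finset.mem_Icc.1 n.2).1 (Finset.mem_Icc.1 n.2).2
    exact ⟨(t, t'), h⟩
  choose q hq using hex
  refine ⟨fun n => (r : ℤ) - (q n).1 - (q n).2, fun n t t' hg h1 h2 => ?_⟩
  have := (hq n).1.eq_or_le T.2 hg (hq n).2.1 (hq n).2.2 h1 h2 le_rfl
  have := (hq n).1.lt
  have := (hq n).2
  dsimp only
  omega

theorem descents_bijective (r : ℕ) :
    Function.Bijective (descents : Tuples r → Subsets r) := by
  constructor
  · intro eps eps' h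
    apply Subtype.ext
    funext n
    obtain ⟨t, t', hg, h1, h2⟩ := exists_isGap (T := (descents eps).1) (Finset.mem_Icc.1 n.2).1
      (Finset.mem_Icc.1 n.2).2
    rw [eq_sub_of_isGap_descents eps hg n h1 h2,
      eq_sub_of_isGap_descents eps' (h ▸ hg) n h1 h2]
  · intro T
    obtain ⟨eps, h⟩ := exists_tuple_of_isGap T
    exact ⟨⟨eps, isDeviationTuple_of_isGap T h⟩, descents_of_isGap T _ h⟩

/-! ### The product of reversals -/

theorem breakpoint_succ_of_lt {r : ℕ} (T : Subsets r) {i : ℕ} (hi : i < T.1.card) :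
    breakpoint T (i + 1) = (T.1.sort (· ≤ ·))[i]'(by rwa [Finset.length_sort]) := by
  unfold breakpoint
  rw [if_neg (Nat.succ_ne_zero i), Nat.add_sub_cancel, List.getD_eq_getElem]

theorem breakpoint_succ_of_le {r : ℕ} (T : Subsets r) {i : ℕ} (hi : T.1.card ≤ i) :
    breakpoint T (i + 1) = r := by
  unfold breakpoint
  rw [if_neg (Nat.succ_ne_zero i), Nat.add_sub_cancel, List.getD_eq_default]
  rwa [Finset.length_sort]

theorem breakpoint_succ_mem {r : ℕ} (T : Subsets r) {i : ℕ} (hi : i < T.1.card) :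
    breakpoint T (i + 1) ∈ T.1 := by
  rw [breakpoint_succ_of_lt T hi, ← Finset.mem_sort (· ≤ ·)]
  exact List.getElem_mem _

theorem breakpoint_lt_succ {r : ℕ} (hr : 1 ≤ r) (T : Subsets r) {i : ℕ} (hi : i ≤ T.1.card) :
    breakpoint T i < breakpoint T (i + 1) := by
  have hT : ∀ u ∈ T.1, 1 ≤ u ∧ u ≤ r - 1 := fun u hu => Finset.mem_Icc.1 (T.2 hu)
  rcases hi.lt_or_eq with hlt | rfl
  · cases i with
    | zero =>
      have := hT _ (breakpoint_succ_mem T hlt)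
      simp only [breakpoint, if_true] at this ⊢
      omega
    | succ i =>
      rw [breakpoint_succ_of_lt T hlt, breakpoint_succ_of_lt T (Nat.lt_of_succ_lt hlt)]
      exact List.pairwise_iff_getElem.1 (Finset.sortedLT_sort T.1).pairwise _ _ _ _
        (Nat.lt_succ_self i)
  · rw [breakpoint_succ_of_le T le_rfl]
    cases h : T.1.card with
    | zero => simpa [breakpoint] using Nat.pos_of_ne_zero (Nat.one_le_iff_ne_zero.1 hr)
    | succ i =>
      have := hT _ (breakpoint_succ_mem T (i := i) (by omega))
      omega

theorem breakpoint_mono {r : ℕ} (hr : 1 ≤ r) (T : Subsets r) {i j : ℕ} (hij : i ≤ j)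
    (hj : j ≤ T.1.card + 1) : breakpoint T i ≤ breakpoint T j := by
  induction j, hij using Nat.le_induction with
  | base => exact le_rfl
  | succ j _ ih => exact (ih (by omega)).trans (breakpoint_lt_succ hr T (by omega)).le

theorem exists_breakpoint_eq {r : ℕ} (T : Subsets r) {u : ℕ} (hu : u ∈ T.1) :
    ∃ i < T.1.card, breakpoint T (i + 1) = u := by
  rw [← Finset.mem_sort (· ≤ ·)] at hu
  obtain ⟨i, hi, e⟩ := List.getElem_of_mem hu
  rw [Finset.length_sort] at hi
  exact ⟨i, hi, (breakpoint_succ_of_lt T hi).trans e⟩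

/-- The gaps of `T` are the pairs of consecutive breakpoints. -/
theorem IsGap.exists_breakpoint {r : ℕ} (hr : 1 ≤ r) (T : Subsets r) {t t' : ℕ}
    (hg : IsGap r T.1 t t') :
    ∃ i ≤ T.1.card, t = breakpoint T i ∧ t' = breakpoint T (i + 1) := by
  obtain ⟨i, hi, rfl⟩ : ∃ i ≤ T.1.card, t = breakpoint T i := by
    rcases hg.left with h | h
    · exact ⟨0, Nat.zero_le _, by simp [breakpoint, h]⟩
    · obtain ⟨i, hi, e⟩ := exists_breakpoint_eq T h
      exact ⟨i + 1, hi, e.symm⟩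
  refine ⟨i, hi, rfl, ?_⟩
  have hlt := hg.lt
  have h1 := breakpoint_lt_succ hr T hi
  apply le_antisymm
  · rcases hi.lt_or_eq with h | h
    · have := hg.not_between _ (breakpoint_succ_mem T h)
      omega
    · rw [breakpoint_succ_of_le T h.ge]
      exact hg.le T.2
  · obtain ⟨j, hj, rfl⟩ : ∃ j ≤ T.1.card, t' = breakpoint T (j + 1) := by
      rcases hg.right with h | h
      · exact ⟨T.1.card, le_rfl, h.trans (breakpoint_succ_of_le T le_rfl).symm⟩
      · obtain ⟨j, hj, e⟩ := exists_breakpoint_eq T h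
        exact ⟨j, hj.le, e.symm⟩
    apply breakpoint_mono hr T _ (by omega)
    by_contra hji
    have := breakpoint_mono hr T (show j + 1 ≤ i by omega) (by omega)
    omega

/-- A product of permutations in which only one factor moves `a` or `b`, and that factor maps `a`
to `b`, maps `a` to `b`. -/
theorem list_prod_apply_of_forall_ne {α : Type*} {n : ℕ} (f : Fin n → Equiv.Perm α) (i : Fin n)
    {a b : α} (hi : f i a = b) (hne : ∀ j, j ≠ i → f j a = a ∧ f j b = b) :
    (List.ofFn f).prod a = b := by
  have hfix : ∀ (m : ℕ) (g : Fin m → Equiv.Perm α) (c : α), (∀ j, g j c = c) →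
      (List.ofFn g).prod c = c := by
    intro m
    induction m with
    | zero => intro g c _; simp
    | succ m ih =>
      intro g c h
      rw [List.ofFn_succ, List.prod_cons, Equiv.Perm.mul_apply, ih _ _ fun j => h _, h]
  induction n with
  | zero => exact i.elim0
  | succ n ih =>
    rw [List.ofFn_succ, List.prod_cons, Equiv.Perm.mul_apply]
    cases i using Fin.cases with
    | zero =>
      rw [hfix _ _ _ fun j => (hne _ (Fin.succ_ne_zero j)).1, hi]
    | succ i =>
      rw [ih (fun j => f j.succ) i hi fun j hj => hne _ fun e => hj (Fin.succ_injective _ e)]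
      exact (hne 0 (Fin.succ_ne_zero i).symm).2

theorem coe_Rev_apply (r i j : ℕ) (n : Idx r) :
    ((Rev r i j n : Idx r) : ℕ) =
      if i ≤ n.1 ∧ n.1 ≤ j ∧ i + j - n.1 ∈ Finset.Icc 1 r then i + j - n.1 else n.1 := by
  change ((revFun r i j n : Idx r) : ℕ) = _
  unfold revFun
  split_ifs <;> rfl

/-- The product of the reversals reverses every gap. -/
theorem permOfSubset_apply_of_isGap {r : ℕ} (hr : 1 ≤ r) (T : Subsets r) {t t' : ℕ}
    (hg : IsGap r T.1 t t') (n : Idx r) (h1 : t < n) (h2 : (n : ℕ) ≤ t') :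
    ((permOfSubset T n : Idx r) : ℕ) = t + t' + 1 - n := by
  obtain ⟨i, hi, rfl, rfl⟩ := hg.exists_breakpoint hr T
  have hle := hg.le T.2
  have hm : breakpoint T i + breakpoint T (i + 1) + 1 - n ∈ Finset.Icc 1 r := by
    rw [Finset.mem_Icc]; omega
  suffices permOfSubset T n = ⟨_, hm⟩ by rw [this]
  refine list_prod_apply_of_forall_ne _ ⟨i, by omega⟩ (Subtype.ext ?_) fun j hj => ?_
  · rw [coe_Rev_apply, if_pos]
    · dsimp only; omega
    · rw [Finset.mem_Icc]; dsimp only; omega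
  · have hj2 := j.2
    have : (j : ℕ) ≠ i := fun e => hj (Fin.ext e)
    have hsep : breakpoint T (j + 1) ≤ breakpoint T i ∨
        breakpoint T (i + 1) ≤ breakpoint T j := by
      rcases Nat.lt_or_gt_of_ne this with h | h
      · exact .inl (breakpoint_mono hr T h (by omega))
      · exact .inr (breakpoint_mono hr T h (by omega))
    constructor <;> refine Subtype.ext ?_ <;> rw [coe_Rev_apply, if_neg]
    · omega
    · dsimp only; omega

/-! ### Trapezoidal sequences -/

/-- A symmetric sequence which grows by `1` as long as it satisfies `c n = n`, and does not grow
any more afterwards, is a trapezoid. -/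
theorem exists_trapezoid {m : ℕ} {c : ℕ → ℕ} (hle : ∀ n ≤ m, c n ≤ n)
    (hstep : ∀ n, n + 1 ≤ m → c n < n → c (n + 1) ≤ c n) (hsymm : ∀ n ≤ m, c (m - n) = c n) :
    ∃ a, 2 * a ≤ m ∧ (∀ n ≤ m, c n = n ↔ n ≤ a) ∧ ∑ n ∈ Finset.range (m + 1), c n = a * (m - a) := by
  classical
  have h0 : c 0 = 0 := Nat.le_zero.1 (hle 0 (Nat.zero_le m))
  have hdown : ∀ n, n + 1 ≤ m → c (n + 1) = n + 1 → c n = n := by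
    intro n hn h
    by_contra hne
    have h1 := hle n (by omega)
    have h2 := hstep n hn (by omega)
    omega
  obtain ⟨a, ham, haa, hmax⟩ : ∃ a ≤ m, c a = a ∧ ∀ n ≤ m, c n = n → n ≤ a := by
    refine ⟨Nat.findGreatest (fun n => c n = n) m, Nat.findGreatest_le m,
      Nat.findGreatest_spec (P := fun n => c n = n) (Nat.zero_le m) h0, fun n hn h => ?_⟩
    exact Nat.le_findGreatest hn h
  have hiff : ∀ n ≤ m, c n = n ↔ n ≤ a := by
    intro n hn
    refine ⟨hmax n hn, fun hna => ?_⟩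
    induction hna using Nat.decreasingInduction with
    | self => exact haa
    | of_succ k hk ih => exact hdown k (by omega) (ih (by omega))
  have h2a : 2 * a ≤ m := by
    by_contra h
    have h1 := (hiff (m - a) (by omega)).2 (by omega)
    have h2 := hsymm a ham
    omega
  have hanti : ∀ n n', a ≤ n → n ≤ n' → n' ≤ m → c n' ≤ c n := by
    intro n n' han hnn' hn'
    induction n', hnn' using Nat.le_induction with
    | base => exact le_rfl
    | succ k hk ih =>
      refine le_trans ?_ (ih (by omega))
      rcases lt_or_ge (c k) k with h | h
      · exact hstep k hn' h
      · have hka : k = a := le_antisymm (hmax k (by omega) (le_antisymm (hle k (by omega)) h))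
          (by omega)
        have h3 := hle (k + 1) hn'
        have h4 : c (k + 1) ≠ k + 1 := fun e => by have := hmax _ hn' e; omega
        rw [hka] at *
        omega
  have hval : ∀ n ≤ m, c n = min (min n a) (m - n) := by
    intro n hn
    rcases le_or_gt n a with h | h
    · rw [(hiff n hn).2 h]; omega
    rcases le_or_gt n (m - a) with h' | h'
    · have h1 := hanti a n le_rfl h.le hn
      have h2 := hanti n (m - a) h.le h' (by omega)
      have h3 := hsymm a ham
      omega
    · have h1 := hsymm n hn
      have h2 := (hiff (m - n) (by omega)).2 (by omega)
      omega
  refine ⟨a, h2a, hiff, ?_⟩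
  rw [Finset.sum_congr rfl fun n hn => hval n (Nat.lt_succ_iff.1 (Finset.mem_range.1 hn))]
  clear hval hanti hiff hmax haa hdown h0 hle hstep hsymm
  obtain ⟨b, rfl⟩ := Nat.exists_eq_add_of_le h2a
  have key : ∀ a b : ℕ, ∑ n ∈ Finset.range (2 * a + b + 1), min (min n a) (2 * a + b - n) =
      a * (2 * a + b - a) := by
    intro a b
    induction a with
    | zero => simp
    | succ a ih =>
      -- dropping the two outer zeros and lowering the other terms by `1` leaves the trapezoid of
      -- height `a`
      rw [show 2 * (a + 1) + b + 1 = (2 * a + b + 1) + 1 + 1 by ring, Finset.sum_range_succ,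
        Finset.sum_range_succ']
      have : ∀ n ∈ Finset.range (2 * a + b + 1),
          min (min (n + 1) (a + 1)) (2 * (a + 1) + b - (n + 1)) =
            min (min n a) (2 * a + b - n) + 1 := by
        intro n hn
        rw [Finset.mem_range] at hn
        omega
      rw [Finset.sum_congr rfl this, Finset.sum_add_distrib, ih]
      have e1 : 2 * a + b - a = a + b := by omega
      have e2 : 2 * (a + 1) + b - (a + 1) = a + b + 1 := by omega
      rw [e1, e2]
      simp
      ring_nf
      omega
  exact key a b

/-! ### The partition from the ranks -/

theorem sum_sub_eq_sum_sub_succ_add {ι : Type*} [Fintype ι] (lam : ι → ℕ) (k : ℕ) :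
    ∑ i, (lam i - k) = ∑ i, (lam i - (k + 1)) + (Finset.univ.filter fun i => k < lam i).card := by
  rw [Finset.card_filter, ← Finset.sum_add_distrib]
  refine Finset.sum_congr rfl fun i _ => ?_
  split_ifs <;> omega

theorem card_lt_antitone {ι : Type*} [Fintype ι] (lam : ι → ℕ) {k l : ℕ} (h : k ≤ l) :
    (Finset.univ.filter fun i => l < lam i).card ≤ (Finset.univ.filter fun i => k < lam i).card :=
  Finset.card_le_card fun i hi => by
    simp only [Finset.mem_filter, Finset.mem_univ, true_and] at hi ⊢
    omega

/-- In a decreasing sequence, the parts larger than `k` come first. -/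
theorem lt_iff_le_card {r : ℕ} {lam : Idx r → ℕ} (hl : ∀ i j : Idx r, (i : ℕ) ≤ j → lam j ≤ lam i)
    (n : Idx r) (k : ℕ) :
    k < lam n ↔ (n : ℕ) ≤ (Finset.univ.filter fun i => k < lam i).card := by
  have hn := Finset.mem_Icc.1 n.2
  constructor
  · intro h
    rw [← card_filter_coe_le hn.2]
    refine Finset.card_le_card fun i hi => ?_
    simp only [Finset.mem_filter, Finset.mem_univ, true_and] at hi ⊢
    exact h.trans_le (hl i n hi)
  · intro h
    by_contra hk
    have : (Finset.univ.filter fun i => k < lam i).card ≤ (n : ℕ) - 1 := by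
      rw [← card_filter_coe_le (r := r) (q := n - 1) (by omega)]
      refine Finset.card_le_card fun i hi => ?_
      simp only [Finset.mem_filter, Finset.mem_univ, true_and] at hi ⊢
      by_contra hin
      have := hl n i (by omega)
      omega
    omega

/-- The walk `m ↦ m - 2 * a m` moves by `1` in each step. If the numbers `a m * (m - a m)` are the
sums of the truncated differences `lam i - (N - m)`, then between two consecutive zeros `2 * t` and
`2 * t'` the walk goes up to its top and then down: a descent followed by an ascent would contradict
the monotonicity in `k` of the number of parts larger than `k`. -/
theorem part_eq_of_walk {r N : ℕ} (hN : 2 * r ≤ N) {a : ℕ → ℕ} (ha : ∀ m ≤ N, 2 * a m ≤ m)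
    (hstep : ∀ m, m + 1 ≤ N → a m ≤ a (m + 1) ∧ a (m + 1) ≤ a m + 1)
    {lam : Idx r → ℕ} (hl : ∀ i j : Idx r, (i : ℕ) ≤ j → lam j ≤ lam i)
    (hsum : ∀ m ≤ N, ∑ i, (lam i - (N - m)) = a m * (m - a m))
    {t t' : ℕ} (htt' : t < t') (ht' : t' ≤ r) (h1 : a (2 * t) = t) (h2 : a (2 * t') = t')
    (hne : ∀ n, t < n → n < t' → a (2 * n) ≠ n) (n : Idx r) (hn : t < n) (hn' : (n : ℕ) ≤ t') :
    lam n + t + t' = N := by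
  set g : ℕ → ℕ := fun k => (Finset.univ.filter fun i => k < lam i).card with hg
  have hgs : ∀ m, m + 1 ≤ N →
      g (N - (m + 1)) = if a (m + 1) = a m then a m else m - a m := by
    intro m hm
    have e1 := sum_sub_eq_sum_sub_succ_add lam (N - (m + 1))
    rw [show N - (m + 1) + 1 = N - m by omega, hsum m (by omega), hsum (m + 1) hm] at e1
    have e2 := ha m (by omega)
    have e3 := hstep m hm
    obtain ⟨b, hb⟩ := Nat.exists_eq_add_of_le (show a m ≤ m by omega)
    split_ifs with h
    · rw [h, show m + 1 - a m = b + 1 by omega, show m - a m = b by omega, mul_add] at e1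
      change _ = _ + g (N - (m + 1)) at e1
      omega
    · have h' : a (m + 1) = a m + 1 := by omega
      rw [h', show m + 1 - (a m + 1) = b by omega, show m - a m = b by omega, add_mul] at e1
      change _ = _ + g (N - (m + 1)) at e1
      omega
  -- once the walk goes down it goes down until it reaches `0`
  have hdown : ∀ m, m + 2 ≤ N → a (m + 1) ≠ a m → 2 * a (m + 1) < m + 1 →
      a (m + 2) ≠ a (m + 1) := by
    intro m hm h3 h4 h5
    have e1 := hgs m (by omega)
    have e2 := hgs (m + 1) (by omega)
    rw [if_neg h3] at e1
    rw [if_pos h5] at e2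
    have e3 : g (N - (m + 1)) ≤ g (N - (m + 1 + 1)) := card_lt_antitone lam (by omega)
    have e4 := hstep m (by omega)
    omega
  have hpos : ∀ m, 2 * t < m → m < 2 * t' → 2 * a m < m := by
    intro m hm hm'
    rcases (ha m (by omega)).lt_or_eq with h | h
    · exact h
    · exact absurd (show a (2 * a m) = a m by rw [h]) (hne (a m) (by omega) (by omega))
  -- the first step down
  classical
  have hex : ∃ m, 2 * t ≤ m ∧ m < 2 * t' ∧ a (m + 1) ≠ a m := by
    by_contra hcon
    push Not at hcon
    have : ∀ d, 2 * t + d ≤ 2 * t' → a (2 * t + d) = t := by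
      intro d
      induction d with
      | zero => intro _; exact h1
      | succ d ih =>
        intro hd
        exact (hcon (2 * t + d) (by omega) (by omega)).trans (ih (by omega))
    have := this (2 * t' - 2 * t) (by omega)
    rw [show 2 * t + (2 * t' - 2 * t) = 2 * t' by omega] at this
    omega
  obtain ⟨q, ⟨q1, q2, q3⟩, qmin⟩ : ∃ q, (2 * t ≤ q ∧ q < 2 * t' ∧ a (q + 1) ≠ a q) ∧
      ∀ m, 2 * t ≤ m → m < q → a (m + 1) = a m := by
    refine ⟨Nat.find hex, Nat.find_spec hex, fun m hm hmq => ?_⟩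
    by_contra h
    exact Nat.find_min hex hmq ⟨hm, hmq.trans (Nat.find_spec hex).2.1, h⟩
  have hflat : ∀ d, 2 * t + d ≤ q → a (2 * t + d) = t := by
    intro d
    induction d with
    | zero => intro _; exact h1
    | succ d ih =>
      intro hd
      exact (qmin (2 * t + d) (by omega) (by omega)).trans (ih (by omega))
  have hfall : ∀ d, q + d + 1 ≤ 2 * t' →
      a (q + d + 1) ≠ a (q + d) ∧ a (q + d + 1) = t + d + 1 := by
    intro d
    induction d with
    | zero =>
      intro hd
      have e1 := hflat (q - 2 * t) (by omega)
      rw [show 2 * t + (q - 2 * t) = q by omega] at e1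
      have e2 := hstep q (by omega)
      simp only [add_zero]
      exact ⟨q3, by omega⟩
    | succ d ih =>
      intro hd
      obtain ⟨i1, i2⟩ := ih (by omega)
      have e1 := hdown (q + d) (by omega) i1 (hpos _ (by omega) (by omega))
      have e2 := hstep (q + d + 1) (by omega)
      rw [show q + (d + 1) + 1 = q + d + 2 by ring, show q + (d + 1) = q + d + 1 by ring]
      rw [show q + d + 1 + 1 = q + d + 2 by ring] at e2
      exact ⟨e1, by omega⟩
  have hq : q = t + t' := by
    have := (hfall (2 * t' - 1 - q) (by omega)).2
    rw [show q + (2 * t' - 1 - q) + 1 = 2 * t' by omega] at this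
    omega
  have haq : a q = t := by
    have := hflat (q - 2 * t) (by omega)
    rwa [show 2 * t + (q - 2 * t) = q by omega] at this
  have g1 := hgs q (by omega)
  rw [if_neg q3] at g1
  have g2 := hgs (q - 1) (by omega)
  have haq' : a (q - 1) = t := by
    have := hflat (q - 1 - 2 * t) (by omega)
    rwa [show 2 * t + (q - 1 - 2 * t) = q - 1 by omega] at this
  rw [show q - 1 + 1 = q by omega, if_pos (haq.trans haq'.symm)] at g2
  have l1 := (lt_iff_le_card hl n (N - (q + 1))).2 (by change _ ≤ g _; omega)
  have l2 := (lt_iff_le_card hl n (N - q)).not.2 (by change ¬ _ ≤ g _; omega)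
  omega

/-! ### Toeplitz matrices of binomial coefficients -/

section Toeplitz

open Polynomial

variable (F : Type*) [Field F]

/-- The `p × n` Toeplitz matrix with `(i, j)`-entry `k choose (s - p + i - j)`. For
`k + p + n = r + s` it is the matrix of multiplication by `(x + y)^k` from degree `n - 1` to degree
`n - 1 + k` in `F[x, y] / (x^r, y^s)`, in the monomial bases by powers of `y`; the monomials which
vanish in the quotient contribute zero rows or columns. -/
def toeplitz (s k p n : ℕ) : Matrix (Fin p) (Fin n) F :=
  Matrix.of fun i j => (chooseInt k ((s : ℤ) - (p : ℤ) + ((i : ℕ) : ℤ) - ((j : ℕ) : ℤ)) : F)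

/-- The polynomials `f` in `y` of degree less than `n` which, made homogeneous of degree `n - 1`,
are annihilated by `(x + y)^k` in `F[x, y] / (x^r, y^s)`. Here `x = 1`, and the vanishing in the
quotient is a condition on the coefficients with index from `n + k - r` to `s - 1`. -/
def powKer (r s k n : ℕ) : Submodule F F[X] where
  carrier := {f : F[X] | f ∈ degreeLT F n ∧
    ∀ i : ℕ, n + k ≤ i + r → i < s → ((1 + X) ^ k * f).coeff i = (0 : F)}
  add_mem' := by
    rintro f g ⟨hf, hf'⟩ ⟨hg, hg'⟩
    exact ⟨add_mem hf hg, fun i h1 h2 => by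
      rw [mul_add, coeff_add, hf' i h1 h2, hg' i h1 h2, add_zero]⟩
  zero_mem' := ⟨zero_mem _, by simp⟩
  smul_mem' := by
    rintro a f ⟨hf, hf'⟩
    exact ⟨Submodule.smul_mem _ a hf, fun i h1 h2 => by
      rw [mul_smul_comm, coeff_smul, hf' i h1 h2, smul_zero]⟩

variable {F}

theorem coeff_one_add_X_pow_mul {n : ℕ} {f : F[X]} (hf : f ∈ degreeLT F n) (k q : ℕ) :
    ((1 + X) ^ k * f).coeff q =
      ∑ j : Fin n, (chooseInt k ((q : ℤ) - ((j : ℕ) : ℤ)) : F) * f.coeff j := by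
  have hsum : f = ∑ j ∈ Finset.range n, C (f.coeff j) * X ^ j := by
    ext q
    simp only [finsetSum_coeff, coeff_C_mul_X_pow, Finset.sum_ite_eq, Finset.mem_range]
    split_ifs with hq
    · rfl
    · exact (degree_lt_iff_coeff_zero f n).1 (mem_degreeLT.1 hf) q (not_lt.1 hq)
  conv_lhs => rw [hsum]
  rw [Finset.mul_sum, finsetSum_coeff, Finset.sum_range]
  refine Finset.sum_congr rfl fun j _ => ?_
  rw [mul_left_comm, coeff_C_mul, coeff_mul_X_pow', mul_comm]
  congr 1
  unfold chooseInt
  split_ifs with h1 h2 h2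
  · rw [coeff_one_add_X_pow, Int.cast_natCast,
      show ((q : ℤ) - ((j : ℕ) : ℤ)).toNat = q - j by omega]
  · omega
  · omega
  · simp

theorem rank_toeplitz_add_finrank {r s k p n : ℕ} (h : k + p + n = r + s) :
    (toeplitz F s k p n).rank + Module.finrank F (powKer F r s k n) = n := by
  have e : powKer F r s k n = (LinearMap.ker (toeplitz F s k p n).mulVecLin).map
      ((degreeLT F n).subtype ∘ₗ ((degreeLTEquiv F n).symm : (Fin n → F) →ₗ[F] degreeLT F n)) := by
    have key : ∀ f (hf : f ∈ degreeLT F n), (toeplitz F s k p n).mulVec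
        (degreeLTEquiv F n ⟨f, hf⟩) = 0 ↔
          ∀ i, n + k ≤ i + r → i < s → ((1 + X) ^ k * f).coeff i = 0 := by
      intro f hf
      have hc : ∀ i : Fin p, (toeplitz F s k p n).mulVec (degreeLTEquiv F n ⟨f, hf⟩) i =
          ∑ j : Fin n, (chooseInt k ((s : ℤ) - (p : ℤ) + ((i : ℕ) : ℤ) - ((j : ℕ) : ℤ)) : F)
            * f.coeff j := fun i => rfl
      constructor
      · intro h0 i h1 h2
        rw [coeff_one_add_X_pow_mul hf]
        have := congrFun h0 ⟨i + p - s, by omega⟩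
        rw [hc] at this
        refine Eq.trans ?_ this
        refine Finset.sum_congr rfl fun j _ => ?_
        congr 3
        dsimp only
        omega
      · intro h0
        funext i
        rw [hc]
        by_cases hi : p ≤ s + i
        · have := h0 (s + i - p) (by omega) (by omega)
          rw [coeff_one_add_X_pow_mul hf] at this
          refine Eq.trans ?_ this
          refine Finset.sum_congr rfl fun j _ => ?_
          congr 3
          omega
        · refine Finset.sum_eq_zero fun j _ => ?_
          rw [chooseInt, if_neg (by omega)]
          simp
    ext f
    rw [Submodule.mem_map]
    constructor
    · rintro ⟨hf, h0⟩
      exact ⟨degreeLTEquiv F n ⟨f, hf⟩, (key f hf).2 h0, by simp⟩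
    · rintro ⟨v, hv, rfl⟩
      refine ⟨Subtype.coe_prop _, (key _ (Subtype.coe_prop _)).1 ?_⟩
      simpa using hv
  have hinj : Function.Injective
      ((degreeLT F n).subtype ∘ₗ ((degreeLTEquiv F n).symm : (Fin n → F) →ₗ[F] degreeLT F n)) :=
    (Submodule.subtype_injective _).comp (degreeLTEquiv F n).symm.injective
  rw [e, (Submodule.equivMapOfInjective _ hinj _).symm.finrank_eq, Matrix.rank,
    LinearMap.finrank_range_add_finrank_ker, Module.finrank_fin_fun]

/-- Reversing the order of rows and of columns transposes a Toeplitz matrix. -/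
theorem rank_toeplitz_symm (s k p n : ℕ) :
    (toeplitz F s k n p).rank = (toeplitz F s k p n).rank := by
  have : toeplitz F s k n p =
      ((toeplitz F s k p n).submatrix Fin.revPerm Fin.revPerm).transpose := by
    ext i j
    simp only [toeplitz, Matrix.of_apply, Matrix.transpose_apply, Matrix.submatrix_apply,
      Fin.revPerm_apply, Fin.val_rev]
    congr 2
    omega
  rw [this, Matrix.rank_transpose, Matrix.rank_submatrix]

instance (r s k n : ℕ) : FiniteDimensional F (powKer F r s k n) := by
  have : FiniteDimensional F (degreeLT F n) :=
    LinearEquiv.finiteDimensional (degreeLTEquiv F n).symm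
  exact Submodule.finiteDimensional_of_le (S₂ := degreeLT F n) fun f hf => hf.1

theorem degreeLT_X_mul {n : ℕ} {f : F[X]} (hf : f ∈ degreeLT F n) :
    X * f ∈ degreeLT F (n + 1) := by
  rw [mem_degreeLT, degree_lt_iff_coeff_zero] at hf ⊢
  intro m hm
  obtain ⟨m, rfl⟩ := Nat.exists_eq_add_of_lt (Nat.lt_of_succ_le (n := 0) (m := m) (by omega))
  rw [coeff_X_mul]
  exact hf _ (by omega)

/-- If the kernel is not zero, then it grows with the degree, since it cannot be closed under
multiplication by `y`. -/
theorem finrank_powKer_lt_succ {r s k n : ℕ} (h : 0 < Module.finrank F (powKer F r s k n)) :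
    Module.finrank F (powKer F r s k n) < Module.finrank F (powKer F r s k (n + 1)) := by
  have hle : powKer F r s k n ≤ powKer F r s k (n + 1) := fun f hf =>
    ⟨degreeLT_mono (Nat.le_succ n) hf.1, fun i h1 h2 => hf.2 i (by omega) h2⟩
  have hX : ∀ f ∈ powKer F r s k n, X * f ∈ powKer F r s k (n + 1) := by
    intro f hf
    refine ⟨degreeLT_X_mul hf.1, fun i h1 h2 => ?_⟩
    rw [mul_left_comm]
    cases i with
    | zero => rw [coeff_X_mul_zero]
    | succ i => rw [coeff_X_mul]; exact hf.2 i (by omega) (by omega)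
  refine Submodule.finrank_lt_finrank_of_lt (lt_of_le_of_ne hle fun heq => ?_)
  obtain ⟨⟨f, hf⟩, hf0⟩ := (Module.finrank_pos_iff_exists_ne_zero (R := F)).1 h
  have hf0' : f ≠ 0 := fun e => hf0 (Subtype.ext e)
  have hpow : ∀ i : ℕ, X ^ i * f ∈ powKer F r s k n := by
    intro i
    induction i with
    | zero => simpa using hf
    | succ i ih =>
      rw [pow_succ', mul_assoc, heq]
      exact hX _ ih
  have := mem_degreeLT.1 (hpow n).1
  rw [degree_mul, degree_X_pow] at this
  have h2 := zero_le_degree_iff.2 hf0'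
  have : (n : WithBot ℕ) + 0 ≤ n + f.degree := by gcongr
  rw [add_zero] at this
  exact absurd this (not_le_of_gt ‹_›)

theorem powKer_le_succ_pow (r s k n : ℕ) : powKer F r s k n ≤ powKer F r s (k + 1) n := by
  intro f hf
  refine ⟨hf.1, fun i h1 h2 => ?_⟩
  rw [pow_succ', mul_assoc, add_mul, one_mul, coeff_add, hf.2 i (by omega) h2, zero_add]
  cases i with
  | zero => rw [coeff_X_mul_zero]
  | succ i => rw [coeff_X_mul]; exact hf.2 i (by omega) (by omega)

theorem one_add_X_mul_mem_powKer {r s k n : ℕ} {f : F[X]} (hf : f ∈ powKer F r s (k + 1) n) :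
    (1 + X) * f ∈ powKer F r s k (n + 1) := by
  refine ⟨?_, fun i h1 h2 => ?_⟩
  · rw [add_mul, one_mul]
    exact add_mem (degreeLT_mono (Nat.le_succ n) hf.1) (degreeLT_X_mul hf.1)
  · rw [← mul_assoc, ← pow_succ]
    exact hf.2 i (by omega) h2

/-- For `k = s - r` and `n = r`, the conditions on `(1 + y)^k f` say that its degree is less than
`s - r`, but it is a multiple of a monic polynomial of this degree. -/
theorem powKer_self_eq_bot {r s : ℕ} (hrs : r ≤ s) : powKer F r s (s - r) r = ⊥ := by
  rw [eq_bot_iff]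
  intro f hf
  rw [Submodule.mem_bot]
  by_contra h0
  have hd : f.natDegree < r := (natDegree_lt_iff_degree_lt h0).2 (mem_degreeLT.1 hf.1)
  have hm : ((1 + X : F[X]) ^ (s - r)).Monic := by
    rw [add_comm]; exact (monic_X_add_C (1 : F)).pow _
  have hdm : ((1 + X : F[X]) ^ (s - r) * f).natDegree = s - r + f.natDegree := by
    rw [hm.natDegree_mul' h0, natDegree_pow, add_comm (1 : F[X]), ← C_1, natDegree_X_add_C, mul_one]
  have := hf.2 _ (by omega) (by omega : s - r + f.natDegree < s)
  rw [← hdm, coeff_natDegree, leadingCoeff_eq_zero] at this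
  exact mul_ne_zero hm.ne_zero h0 this

theorem rank_toeplitz_eq_iff {r s k p n : ℕ} (h : k + p + n = r + s) :
    (toeplitz F s k p n).rank = n ↔ powKer F r s k n = ⊥ := by
  have := rank_toeplitz_add_finrank (F := F) h
  rw [← Submodule.finrank_eq_zero]
  omega

theorem det_ne_zero_iff_rank_eq {n : ℕ} (A : Matrix (Fin n) (Fin n) F) :
    A.det ≠ 0 ↔ A.rank = n := by
  constructor
  · intro h
    rw [Matrix.rank_of_isUnit _ ((Matrix.isUnit_iff_isUnit_det _).2 h.isUnit), Fintype.card_fin]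
  · intro h h0
    obtain ⟨v, hv, hv'⟩ := Matrix.exists_mulVec_eq_zero_iff.2 h0
    have := LinearMap.finrank_range_add_finrank_ker A.mulVecLin
    rw [Module.finrank_fin_fun] at this
    have hker : Module.finrank F (LinearMap.ker A.mulVecLin) = 0 := by
      rw [Matrix.rank] at h; omega
    rw [Submodule.finrank_eq_zero] at hker
    exact hv (LinearMap.ker_eq_bot'.1 hker v hv')

/-- For `m = r + s - k`, the number `a m` is the largest `n` such that `(x + y)^k` is injective on
the forms of degree less than `n`. It is nondecreasing because the kernel grows with `k`, and it
grows by at most `1` because multiplication by `x + y` maps the kernel of `(x + y)^(k + 1)` in one degree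
to the kernel of `(x + y)^k` in the next. -/
theorem exists_walk (F : Type*) [Field F] {r s : ℕ} (hrs : r ≤ s) :
    ∃ a : ℕ → ℕ, (∀ m ≤ r + s, 2 * a m ≤ m) ∧
      (∀ m, m + 1 ≤ r + s → a m ≤ a (m + 1) ∧ a (m + 1) ≤ a m + 1) ∧
      (∀ n ≤ r, a (2 * n) = n ↔ (D r s n : F) ≠ 0) ∧ a (2 * r) = r ∧
      ∀ m ≤ r + s, ∑ n ∈ Finset.range (m + 1), (toeplitz F s (r + s - m) (m - n) n).rank =
        a m * (m - a m) := by
  have hex : ∀ m, ∃ a, m ≤ r + s → 2 * a ≤ m ∧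
      (∀ n ≤ m, powKer F r s (r + s - m) n = ⊥ ↔ n ≤ a) ∧
      ∑ n ∈ Finset.range (m + 1), (toeplitz F s (r + s - m) (m - n) n).rank = a * (m - a) := by
    intro m
    by_cases hm : m ≤ r + s
    swap
    · exact ⟨0, fun h => absurd h hm⟩
    have hrk := fun n (hn : n ≤ m) => rank_toeplitz_add_finrank (F := F)
      (show r + s - m + (m - n) + n = r + s by omega)
    obtain ⟨a, h1, h2, h3⟩ := exists_trapezoid (m := m)
      (c := fun n => (toeplitz F s (r + s - m) (m - n) n).rank)
      (fun n hn => by have := hrk n hn; omega)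
      (fun n hn hlt => by
        have e1 := hrk n (by omega)
        have e2 := hrk (n + 1) hn
        have e3 := finrank_powKer_lt_succ (F := F) (r := r) (s := s) (k := r + s - m) (n := n)
          (by omega)
        omega)
      (fun n hn => by
        rw [show m - (m - n) = n by omega, rank_toeplitz_symm])
    refine ⟨a, fun _ => ⟨h1, fun n hn => ?_, h3⟩⟩
    rw [← h2 n hn, rank_toeplitz_eq_iff (r := r) (by omega)]
  choose a ha using hex
  refine ⟨a, fun m hm => (ha m hm).1, fun m hm => ?_, fun n hn => ?_, ?_,
    fun m hm => (ha m hm).2.2⟩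
  · obtain ⟨h1, h2, -⟩ := ha m (by omega)
    obtain ⟨h3, h4, -⟩ := ha (m + 1) hm
    obtain ⟨k, hk⟩ : ∃ k, k = r + s - (m + 1) := ⟨_, rfl⟩
    rw [show r + s - m = k + 1 by omega] at h2
    rw [← hk] at h4
    constructor
    · rw [← h4 _ (by omega), eq_bot_iff, ← (h2 _ (by omega)).2 le_rfl]
      exact powKer_le_succ_pow r s k _
    · rcases Nat.eq_zero_or_pos (a (m + 1)) with h0 | h0
      · omega
      suffices a (m + 1) - 1 ≤ a m by omega
      rw [← h2 _ (by omega), eq_bot_iff]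
      intro f hf
      have := one_add_X_mul_mem_powKer hf
      rw [Nat.sub_add_cancel h0, (h4 _ (by omega)).2 le_rfl, Submodule.mem_bot,
        mul_eq_zero] at this
      refine this.resolve_left ?_
      rw [add_comm]
      exact (monic_X_add_C (1 : F)).ne_zero
  · obtain ⟨h1, h2, -⟩ := ha (2 * n) (by omega)
    have e : (D r s n : F) = (toeplitz F s (r + s - 2 * n) n n).det := by
      unfold D toeplitz
      rw [Int.cast_det]
      congr 1
      ext i j
      simp only [Matrix.map_apply, Matrix.of_apply, add_comm r s]
    rw [e, det_ne_zero_iff_rank_eq, rank_toeplitz_eq_iff (r := r) (by omega), h2 n (by omega)]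
    omega
  · obtain ⟨h1, h2, -⟩ := ha (2 * r) (by omega)
    have := (h2 r (by omega)).1 (by
      rw [show r + s - 2 * r = s - r by omega]; exact powKer_self_eq_bot hrs)
    omega

end Toeplitz

/-! ### Ranks of matrices given by blocks -/

section Rank

variable {F : Type*} [Field F]

theorem rank_blockDiagonal' {o : Type*} [Fintype o] [DecidableEq o] {m n : o → Type*}
    [∀ i, Fintype (n i)] [∀ i, Fintype (m i)] (M : ∀ i, Matrix (m i) (n i) F) :
    (Matrix.blockDiagonal' M).rank = ∑ i, (M i).rank := by
  have hmul : ∀ (v : (Σ i, n i) → F) (k : o) (i : m k), (Matrix.blockDiagonal' M).mulVec v ⟨k, i⟩ =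
      (M k).mulVec (fun j => v ⟨k, j⟩) i := by
    intro v k i
    simp only [Matrix.mulVec, dotProduct]
    rw [Fintype.sum_sigma, Finset.sum_eq_single k]
    · simp only [Matrix.blockDiagonal'_apply_eq]
    · intro k' _ hk
      exact Finset.sum_eq_zero fun j _ => by
        rw [Matrix.blockDiagonal'_apply_ne _ _ _ hk.symm, zero_mul]
    · simp
  let φ : ((i : o) → LinearMap.range (M i).mulVecLin) →ₗ[F] ((Σ i, m i) → F) :=
    LinearMap.pi fun x => LinearMap.proj x.2 ∘ₗ Submodule.subtype _ ∘ₗ LinearMap.proj x.1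
  have hφ : ∀ w k i, φ w ⟨k, i⟩ = (w k).1 i := fun w k i => rfl
  have hinj : Function.Injective φ := by
    intro w w' h
    funext k
    apply Subtype.ext
    funext i
    rw [← hφ, ← hφ, h]
  have hrange : LinearMap.range φ = LinearMap.range (Matrix.blockDiagonal' M).mulVecLin := by
    ext u
    constructor
    · rintro ⟨w, rfl⟩
      have : ∀ k, ∃ v, (M k).mulVecLin v = (w k).1 := fun k => (w k).2
      choose v hv using this
      refine ⟨fun x => v x.1 x.2, ?_⟩
      ext ⟨k, i⟩
      rw [hφ, ← hv k]
      exact hmul _ k i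
    · rintro ⟨v, rfl⟩
      refine ⟨fun k => ⟨_, fun j => v ⟨k, j⟩, rfl⟩, ?_⟩
      ext ⟨k, i⟩
      exact (hmul v k i).symm
  rw [Matrix.rank, ← hrange, LinearMap.finrank_range_of_inj hinj, Module.finrank_pi_fintype]
  rfl

/-- Zero rows and columns do not contribute to the rank. -/
theorem rank_submatrix_of_support {m n m₀ n₀ : Type*} [Fintype m] [Fintype n] [Fintype m₀]
    [Fintype n₀] (A : Matrix m n F) {f : m₀ → m} {g : n₀ → n}
    (hf : Function.Injective f) (hg : Function.Injective g)
    (h : ∀ i j, A i j ≠ 0 → i ∈ Set.range f ∧ j ∈ Set.range g) :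
    (A.submatrix f g).rank = A.rank := by
  classical
  refine le_antisymm (Matrix.rank_submatrix_le A f g) ?_
  have e : A = (Matrix.of fun i a => if f a = i then (1 : F) else 0) * A.submatrix f g *
      (Matrix.of fun b j => if g b = j then (1 : F) else 0) := by
    ext i j
    simp only [Matrix.mul_apply, Matrix.of_apply, Matrix.submatrix_apply, ite_mul, one_mul,
      zero_mul, mul_ite, mul_one, mul_zero]
    by_cases hA : A i j = 0
    · rw [hA]
      symm
      refine Finset.sum_eq_zero fun b _ => ?_
      split_ifs with hb
      · refine Finset.sum_eq_zero fun a _ => ?_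
        split_ifs with ha
        · rw [ha, hb, hA]
        · rfl
      · rfl
    · obtain ⟨⟨a, rfl⟩, b, rfl⟩ := h i j hA
      simp [hf.eq_iff, hg.eq_iff]
  conv_lhs => rw [e]
  exact (Matrix.rank_mul_le_left _ _).trans (Matrix.rank_mul_le_right _ _)

theorem Similar.rank_pow {m n : Type*} [Fintype m] [Fintype n] [DecidableEq m] [DecidableEq n]
    {A : Matrix m m F} {B : Matrix n n F} (h : Similar A B) (k : ℕ) :
    (A ^ k).rank = (B ^ k).rank := by
  obtain ⟨P, Q, h1, h2, h3⟩ := h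
  have e : ∀ k, A ^ k = P * B ^ k * Q := by
    intro k
    induction k with
    | zero => rw [pow_zero, pow_zero, Matrix.mul_one, h1]
    | succ k ih =>
      rw [pow_succ, ih, h3, pow_succ]
      calc P * B ^ k * Q * (P * B * Q) = P * B ^ k * (Q * P) * B * Q := by
            simp only [Matrix.mul_assoc]
        _ = _ := by rw [h2, Matrix.mul_one, Matrix.mul_assoc P]
  have e' : B ^ k = Q * A ^ k * P := by
    rw [e]
    calc B ^ k = (Q * P) * B ^ k * (Q * P) := by rw [h2, Matrix.one_mul, Matrix.mul_one]
      _ = _ := by simp only [Matrix.mul_assoc]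
  apply le_antisymm
  · rw [e]
    exact (Matrix.rank_mul_le_left _ _).trans (Matrix.rank_mul_le_right _ _)
  · rw [e']
    exact (Matrix.rank_mul_le_left _ _).trans (Matrix.rank_mul_le_right _ _)

theorem Similar.add_one {m n : Type*} [Fintype m] [Fintype n] [DecidableEq m] [DecidableEq n]
    {A : Matrix m m F} {B : Matrix n n F} (h : Similar A B) : Similar (1 + A) (1 + B) := by
  obtain ⟨P, Q, h1, h2, h3⟩ := h
  exact ⟨P, Q, h1, h2, by rw [Matrix.mul_add, Matrix.add_mul, Matrix.mul_one, h1, ← h3]⟩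

theorem Similar.sub_one {m n : Type*} [Fintype m] [Fintype n] [DecidableEq m] [DecidableEq n]
    {A : Matrix m m F} {B : Matrix n n F} (h : Similar A B) : Similar (A - 1) (B - 1) := by
  obtain ⟨P, Q, h1, h2, h3⟩ := h
  exact ⟨P, Q, h1, h2, by rw [Matrix.mul_sub, Matrix.sub_mul, Matrix.mul_one, h1, ← h3]⟩

/-! ### Powers of Jordan blocks -/

theorem nilBlock_apply (l : ℕ) (i j : Fin l) :
    nilBlock F l i j = if (i : ℕ) + 1 = j then 1 else 0 := rfl

theorem nilBlock_pow_apply (l k : ℕ) (i j : Fin l) :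
    (nilBlock F l ^ k) i j = if (i : ℕ) + k = j then 1 else 0 := by
  induction k generalizing i with
  | zero => simp [Matrix.one_apply, Fin.ext_iff]
  | succ k ih =>
    rw [pow_succ', Matrix.mul_apply]
    simp only [ih, nilBlock_apply, ite_mul, one_mul, zero_mul]
    by_cases hi : (i : ℕ) + 1 < l
    · rw [Finset.sum_eq_single ⟨i + 1, hi⟩]
      · simp only [if_true]
        congr 1
        rw [add_assoc, add_comm 1 k]
      · intro b _ hb
        rw [if_neg fun e => hb (Fin.ext e.symm)]
      · simp
    · rw [if_neg (by omega)]
      refine Finset.sum_eq_zero fun b _ => ?_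
      rw [if_neg (by omega)]

theorem rank_nilBlock_pow (l k : ℕ) : (nilBlock F l ^ k).rank = l - k := by
  rw [← rank_submatrix_of_support (nilBlock F l ^ k)
    (f := fun a : Fin (l - k) => (⟨a, by omega⟩ : Fin l))
    (g := fun a : Fin (l - k) => (⟨a + k, by omega⟩ : Fin l))]
  · have : (nilBlock F l ^ k).submatrix (fun a : Fin (l - k) => (⟨a, by omega⟩ : Fin l))
        (fun a : Fin (l - k) => (⟨a + k, by omega⟩ : Fin l)) = 1 := by
      ext a b
      rw [Matrix.submatrix_apply, nilBlock_pow_apply, Matrix.one_apply]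
      simp only [Nat.add_right_cancel_iff, Fin.ext_iff]
    rw [this, Matrix.rank_one, Fintype.card_fin]
  · intro a b h
    simpa [Fin.ext_iff] using h
  · intro a b h
    simpa [Fin.ext_iff] using h
  · intro i j h
    rw [nilBlock_pow_apply] at h
    have h' : (i : ℕ) + k = j := by
      by_contra hne
      exact h (if_neg hne)
    exact ⟨⟨⟨i, by omega⟩, rfl⟩, ⟨⟨i, by omega⟩, Fin.ext h'⟩⟩

theorem isNilpotent_nilBlock (l : ℕ) : IsNilpotent (nilBlock F l) := by
  refine ⟨l, ?_⟩
  ext i j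
  rw [nilBlock_pow_apply, if_neg (by omega), Matrix.zero_apply]

theorem isUnit_jordanBlock (l : ℕ) : IsUnit (jordanBlock F l) :=
  (isNilpotent_nilBlock l).isUnit_one_add

theorem jordanSum_eq_one_add {k : ℕ} (lam : Idx k → ℕ) :
    jordanSum F lam = 1 + Matrix.blockDiagonal' fun n => nilBlock F (lam n) := by
  rw [← Matrix.blockDiagonal'_one, ← Matrix.blockDiagonal'_add]
  rfl

theorem rank_jordanSum_sub_one_pow {k : ℕ} (lam : Idx k → ℕ) (e : ℕ) :
    ((jordanSum F lam - 1) ^ e).rank = ∑ n, (lam n - e) := by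
  rw [jordanSum_eq_one_add, add_sub_cancel_left, ← Matrix.blockDiagonal'_pow, rank_blockDiagonal']
  exact Finset.sum_congr rfl fun n _ => rank_nilBlock_pow _ _

/-! ### The tensor product of two Jordan blocks -/

open scoped Kronecker

/-- Multiplication by `x + y` on `F[x, y] / (x^r, y^s)`, in the basis of the monomials `x^i y^j`, as a
matrix which acts on row vectors. -/
def nilSum (F : Type*) [Field F] (r s : ℕ) : Matrix (Fin r × Fin s) (Fin r × Fin s) F :=
  nilBlock F r ⊗ₖ 1 + 1 ⊗ₖ nilBlock F s

theorem chooseInt_succ (k : ℕ) (z : ℤ) :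
    chooseInt (k + 1) z = chooseInt k z + chooseInt k (z - 1) := by
  unfold chooseInt
  rcases lt_trichotomy z 0 with h | rfl | h
  · rw [if_neg (by omega), if_neg (by omega), if_neg (by omega), add_zero]
  · simp
  · rw [if_pos h.le, if_pos h.le, if_pos (by omega)]
    obtain ⟨n, rfl⟩ : ∃ n : ℕ, z = n + 1 := ⟨(z - 1).toNat, by omega⟩
    rw [show ((n : ℤ) + 1).toNat = n + 1 by omega, show ((n : ℤ) + 1 - 1).toNat = n by omega,
      Nat.choose_succ_succ]
    push_cast
    ring

theorem chooseInt_of_lt {k : ℕ} {z : ℤ} (h : (k : ℤ) < z) : chooseInt k z = 0 := by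
  rw [chooseInt, if_pos (by omega), Nat.choose_eq_zero_of_lt (by omega), Nat.cast_zero]

theorem chooseInt_of_neg {k : ℕ} {z : ℤ} (h : z < 0) : chooseInt k z = 0 := by
  rw [chooseInt, if_neg (by omega)]

theorem nilBlock_kronecker_one_mul_apply {r s : ℕ}
    (A : Matrix (Fin r × Fin s) (Fin r × Fin s) F) (q q' : Fin r × Fin s) :
    ((nilBlock F r ⊗ₖ (1 : Matrix (Fin s) (Fin s) F)) * A) q q' =
      if h : (q.1 : ℕ) + 1 < r then A (⟨q.1 + 1, h⟩, q.2) q' else 0 := by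
  rw [Matrix.mul_apply]
  split_ifs with h
  · rw [Finset.sum_eq_single (⟨q.1 + 1, h⟩, q.2)]
    · simp [nilBlock_apply]
    · rintro ⟨a, b⟩ _ hab
      rw [Matrix.kronecker_apply, nilBlock_apply, Matrix.one_apply]
      split_ifs with h1 h2
      · exact absurd (Prod.ext (Fin.ext h1.symm) h2.symm) hab
      all_goals simp
    · simp
  · refine Finset.sum_eq_zero fun a _ => ?_
    rw [Matrix.kronecker_apply, nilBlock_apply, if_neg (by omega), zero_mul, zero_mul]

theorem one_kronecker_nilBlock_mul_apply {r s : ℕ}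
    (A : Matrix (Fin r × Fin s) (Fin r × Fin s) F) (q q' : Fin r × Fin s) :
    (((1 : Matrix (Fin r) (Fin r) F) ⊗ₖ nilBlock F s) * A) q q' =
      if h : (q.2 : ℕ) + 1 < s then A (q.1, ⟨q.2 + 1, h⟩) q' else 0 := by
  rw [Matrix.mul_apply]
  split_ifs with h
  · rw [Finset.sum_eq_single (q.1, ⟨q.2 + 1, h⟩)]
    · simp [nilBlock_apply]
    · rintro ⟨a, b⟩ _ hab
      rw [Matrix.kronecker_apply, nilBlock_apply, Matrix.one_apply]
      split_ifs with h1 h2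
      · exact absurd (Prod.ext h1.symm (Fin.ext h2.symm)) hab
      all_goals simp
    · simp
  · refine Finset.sum_eq_zero fun a _ => ?_
    rw [Matrix.kronecker_apply, nilBlock_apply, if_neg (by omega), mul_zero, zero_mul]

theorem nilSum_pow_apply (F : Type*) [Field F] (r s k : ℕ) (q q' : Fin r × Fin s) :
    (nilSum F r s ^ k) q q' =
      if (q.1 : ℕ) + q.2 + k = q'.1 + q'.2 then
        (chooseInt k (((q'.2 : ℕ) : ℤ) - ((q.2 : ℕ) : ℤ)) : F) else 0 := by
  induction k generalizing q with
  | zero =>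
    rw [pow_zero, Matrix.one_apply]
    by_cases h : q = q'
    · subst h
      simp [chooseInt]
    · rw [if_neg h]
      split_ifs with h1
      · rcases lt_trichotomy (q.2 : ℕ) q'.2 with h2 | h2 | h2
        · rw [chooseInt_of_lt (by omega), Int.cast_zero]
        · exact absurd (Prod.ext (Fin.ext (by omega)) (Fin.ext h2)) h
        · rw [chooseInt_of_neg (by omega), Int.cast_zero]
      · rfl
  | succ k ih =>
    rw [pow_succ', nilSum, add_mul, Matrix.add_apply, nilBlock_kronecker_one_mul_apply,
      one_kronecker_nilBlock_mul_apply, ← nilSum]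
    simp only [ih]
    have e1 : (if h : (q.1 : ℕ) + 1 < r then
        (if (q.1 : ℕ) + 1 + q.2 + k = q'.1 + q'.2 then
          (chooseInt k (((q'.2 : ℕ) : ℤ) - ((q.2 : ℕ) : ℤ)) : F) else 0) else 0) =
        if (q.1 : ℕ) + q.2 + (k + 1) = q'.1 + q'.2 then
          (chooseInt k (((q'.2 : ℕ) : ℤ) - ((q.2 : ℕ) : ℤ)) : F) else 0 := by
      have := q'.1.2
      split_ifs with h1 h2 h3 h3 h3
      · rfl
      · omega
      · omega
      · rfl
      · rw [chooseInt_of_lt (by omega), Int.cast_zero]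
      · rfl
    have e2 : (if h : (q.2 : ℕ) + 1 < s then
        (if (q.1 : ℕ) + ((q.2 : ℕ) + 1) + k = q'.1 + q'.2 then
          (chooseInt k (((q'.2 : ℕ) : ℤ) - (((q.2 : ℕ) + 1 : ℕ) : ℤ)) : F) else 0) else 0) =
        if (q.1 : ℕ) + q.2 + (k + 1) = q'.1 + q'.2 then
          (chooseInt k (((q'.2 : ℕ) : ℤ) - ((q.2 : ℕ) : ℤ) - 1) : F) else 0 := by
      have := q'.2.2
      split_ifs with h1 h2 h3 h3 h3
      · congr 2
        push_cast
        ring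
      · omega
      · omega
      · rfl
      · rw [chooseInt_of_neg (by omega), Int.cast_zero]
      · rfl
    refine (congrArg₂ (· + ·) e1 e2).trans ?_
    split_ifs with h
    · rw [chooseInt_succ, Int.cast_add]
    · exact add_zero 0

/-- The block diagonal matrix with blocks `W_i`, `i < r`, where the first index of a pair is the number
of the block. -/
def rowDiag {r s : ℕ} (W : Fin r → Matrix (Fin s) (Fin s) F) :
    Matrix (Fin r × Fin s) (Fin r × Fin s) F :=
  Matrix.of fun q q' => if q.1 = q'.1 then W q.1 q.2 q'.2 else 0

theorem kronecker_mul_rowDiag_apply {r s : ℕ} (A : Matrix (Fin r) (Fin r) F)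
    (B : Matrix (Fin s) (Fin s) F) (W : Fin r → Matrix (Fin s) (Fin s) F) (q q' : Fin r × Fin s) :
    ((A ⊗ₖ B) * rowDiag W) q q' = A q.1 q'.1 * (B * W q'.1) q.2 q'.2 := by
  rw [Matrix.mul_apply, Fintype.sum_prod_type, Finset.sum_eq_single q'.1, Matrix.mul_apply,
    Finset.mul_sum]
  · refine Finset.sum_congr rfl fun b _ => ?_
    simp [rowDiag, mul_assoc]
  · intro a _ ha
    exact Finset.sum_eq_zero fun b _ => by simp [rowDiag, ha]
  · simp

theorem rowDiag_mul_kronecker_apply {r s : ℕ} (A : Matrix (Fin r) (Fin r) F)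
    (B : Matrix (Fin s) (Fin s) F) (W : Fin r → Matrix (Fin s) (Fin s) F) (q q' : Fin r × Fin s) :
    (rowDiag W * (A ⊗ₖ B)) q q' = A q.1 q'.1 * (W q.1 * B) q.2 q'.2 := by
  rw [Matrix.mul_apply, Fintype.sum_prod_type, Finset.sum_eq_single q.1, Matrix.mul_apply,
    Finset.mul_sum]
  · refine Finset.sum_congr rfl fun b _ => ?_
    simp [rowDiag, mul_left_comm]
  · intro a _ ha
    exact Finset.sum_eq_zero fun b _ => by simp [rowDiag, ha.symm]
  · simp

theorem rowDiag_mul_rowDiag {r s : ℕ} (V W : Fin r → Matrix (Fin s) (Fin s) F)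
    (h : ∀ i, V i * W i = 1) : rowDiag V * rowDiag W = 1 := by
  ext q q'
  rw [Matrix.mul_apply, Fintype.sum_prod_type, Finset.sum_eq_single q.1]
  · by_cases hq : q.1 = q'.1
    · have := congrFun (congrFun (h q.1) q.2) q'.2
      rw [Matrix.mul_apply] at this
      simp only [rowDiag, Matrix.of_apply, if_true, hq]
      rw [hq] at this
      rw [this, Matrix.one_apply, Matrix.one_apply]
      simp only [Prod.ext_iff, hq, true_and]
    · rw [Matrix.one_apply, if_neg fun e => hq (congrArg Prod.fst e)]
      exact Finset.sum_eq_zero fun b _ => by simp [rowDiag, hq]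
  · intro a _ ha
    exact Finset.sum_eq_zero fun b _ => by simp [rowDiag, ha.symm]
  · simp

/-- In the algebra `F[x, y] / (x^r, y^s)`, the element `(1 + x)(1 + y) - 1 = x (1 + y) + y` becomes
`x + y` after the change of variable which replaces `x (1 + y)` by `x`. -/
theorem similar_kronecker_sub_one (F : Type*) [Field F] (r s : ℕ) :
    Similar (Matrix.kronecker (jordanBlock F r) (jordanBlock F s) - 1) (nilSum F r s) := by
  obtain ⟨J, hJ⟩ := isUnit_jordanBlock (F := F) s
  set W : Fin r → Matrix (Fin s) (Fin s) F := fun i => ((J ^ (r - i : ℕ) : (Matrix _ _ F)ˣ)) with hW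
  set V : Fin r → Matrix (Fin s) (Fin s) F := fun i => ((J ^ (r - i : ℕ))⁻¹ : (Matrix _ _ F)ˣ)
    with hV
  have h1 : rowDiag W * rowDiag V = 1 := rowDiag_mul_rowDiag W V fun i => Units.mul_inv _
  have h2 : rowDiag V * rowDiag W = 1 := rowDiag_mul_rowDiag V W fun i => Units.inv_mul _
  have hcomm : ∀ i, nilBlock F s * W i = W i * nilBlock F s := by
    intro i
    have : Commute (nilBlock F s) (J : Matrix _ _ F) := by
      rw [hJ]
      exact (Commute.one_right _).add_right (Commute.refl _)
    simp only [hW, Units.val_pow_eq_pow_val]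
    exact this.pow_right _
  have hW1 : ∀ i i' : Fin r, (i : ℕ) + 1 = i' → jordanBlock F s * W i' = W i := by
    intro i i' h
    simp only [hW, ← hJ, Units.val_pow_eq_pow_val]
    rw [← pow_succ']
    congr 1
    omega
  have key : (Matrix.kronecker (jordanBlock F r) (jordanBlock F s) - 1) * rowDiag W =
      rowDiag W * nilSum F r s := by
    change ((jordanBlock F r ⊗ₖ jordanBlock F s) - 1) * _ = _
    rw [← Matrix.one_kronecker_one, sub_mul, nilSum, mul_add]
    ext q q'
    rw [Matrix.sub_apply, Matrix.add_apply, kronecker_mul_rowDiag_apply,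
      kronecker_mul_rowDiag_apply, rowDiag_mul_kronecker_apply, rowDiag_mul_kronecker_apply,
      one_mul, mul_one, ← hcomm]
    have e1 : nilBlock F r q.1 q'.1 * (jordanBlock F s * W q'.1) q.2 q'.2 =
        nilBlock F r q.1 q'.1 * W q.1 q.2 q'.2 := by
      rw [nilBlock_apply]
      split_ifs with h
      · rw [hW1 _ _ h]
      · simp
    have e2 : (1 : Matrix (Fin r) (Fin r) F) q.1 q'.1 * (nilBlock F s * W q.1) q.2 q'.2 =
        (1 : Matrix (Fin r) (Fin r) F) q.1 q'.1 * (nilBlock F s * W q'.1) q.2 q'.2 := by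
      rw [Matrix.one_apply]
      split_ifs with h
      · rw [h]
      · simp
    rw [e2, ← e1]
    conv_lhs => rw [jordanBlock, Matrix.add_apply, add_mul, jordanBlock, add_mul, Matrix.add_apply]
    rw [jordanBlock, add_mul, Matrix.add_apply, one_mul]
    ring
  exact ⟨rowDiag W, rowDiag V, h1, h2, by
    rw [← key, Matrix.mul_assoc, h1, Matrix.mul_one]⟩

theorem blockDiagonal'_toeplitz_apply {s k m : ℕ} (x : Σ n : Fin (m + 1), Fin (m - n))
    (y : Σ n : Fin (m + 1), Fin n) :
    Matrix.blockDiagonal' (fun n : Fin (m + 1) => toeplitz F s k (m - n) n) x y =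
      if x.1 = y.1 then (chooseInt k ((s : ℤ) - ((m - (x.1 : ℕ) : ℕ) : ℤ) + ((x.2 : ℕ) : ℤ) -
        ((y.2 : ℕ) : ℤ)) : F) else 0 := by
  obtain ⟨n, i⟩ := x
  obtain ⟨n', j⟩ := y
  by_cases h : n = n'
  · subst h
    rw [Matrix.blockDiagonal'_apply_eq, if_pos rfl]
    rfl
  · rw [Matrix.blockDiagonal'_apply_ne _ _ _ h, if_neg h]

theorem sigma_fin_ext {m : ℕ} {f : Fin m → ℕ} {x y : Σ n : Fin m, Fin (f n)}
    (h1 : (x.1 : ℕ) = y.1) (h2 : (x.2 : ℕ) = y.2) : x = y := by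
  obtain ⟨n, i⟩ := x
  obtain ⟨n', j⟩ := y
  obtain rfl : n = n' := Fin.ext h1
  obtain rfl : i = j := Fin.ext h2
  rfl

/-- The grading by the degree decomposes `(x + y)^k` into Toeplitz matrices. -/
theorem rank_nilSum_pow {r s k m : ℕ} (h : k + m = r + s) :
    (nilSum F r s ^ k).rank =
      ∑ n ∈ Finset.range (m + 1), (toeplitz F s k (m - n) n).rank := by
  set B := Matrix.blockDiagonal' (fun n : Fin (m + 1) => toeplitz F s k (m - n) n) with hB
  have hBr : B.rank = ∑ n ∈ Finset.range (m + 1), (toeplitz F s k (m - n) n).rank := by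
    rw [hB, rank_blockDiagonal', Finset.sum_range]
  rw [← hBr, ← Matrix.rank_transpose B]
  -- rows and columns of degrees for which both the source and the target can be nonzero
  let f : {q : Fin r × Fin s // (q.1 : ℕ) + q.2 + 1 ≤ m} → Σ n : Fin (m + 1), Fin n :=
    fun q => ⟨⟨q.1.1 + q.1.2 + 1, by have := q.2; omega⟩, ⟨q.1.2, by dsimp only; omega⟩⟩
  let g : {q : Fin r × Fin s // k ≤ (q.1 : ℕ) + q.2} → Σ n : Fin (m + 1), Fin (m - n) :=
    fun q => ⟨⟨q.1.1 + q.1.2 + 1 - k, by omega⟩, ⟨r - 1 - q.1.1, by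
      have := q.2; have := q.1.1.2; have := q.1.2.2; dsimp only; omega⟩⟩
  have hf : Function.Injective f := by
    rintro ⟨⟨a, b⟩, h1⟩ ⟨⟨a', b'⟩, h2⟩ h3
    have e1 : (a : ℕ) + b + 1 = a' + b' + 1 := congrArg (fun x => (x.1 : ℕ)) h3
    have e2 : (b : ℕ) = b' := congrArg (fun x => (x.2 : ℕ)) h3
    exact Subtype.ext (Prod.ext (Fin.ext (show (a : ℕ) = a' by omega)) (Fin.ext e2))
  have hg : Function.Injective g := by
    rintro ⟨⟨a, b⟩, h1⟩ ⟨⟨a', b'⟩, h2⟩ h3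
    have e1 : (a : ℕ) + b + 1 - k = a' + b' + 1 - k := congrArg (fun x => (x.1 : ℕ)) h3
    have e2 : r - 1 - (a : ℕ) = r - 1 - a' := congrArg (fun x => (x.2 : ℕ)) h3
    dsimp only at h1 h2
    exact Subtype.ext (Prod.ext (Fin.ext (show (a : ℕ) = a' by omega))
      (Fin.ext (show (b : ℕ) = b' by omega)))
  rw [← rank_submatrix_of_support (nilSum F r s ^ k)
      (f := (Subtype.val : {q : Fin r × Fin s // (q.1 : ℕ) + q.2 + 1 ≤ m} → _))
      (g := (Subtype.val : {q : Fin r × Fin s // k ≤ (q.1 : ℕ) + q.2} → _))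
      Subtype.val_injective Subtype.val_injective,
    ← rank_submatrix_of_support B.transpose hf hg]
  · congr 1
    ext ⟨q, hq⟩ ⟨q', hq'⟩
    have := q'.1.2
    have := q'.2.2
    rw [Matrix.submatrix_apply, Matrix.submatrix_apply, Matrix.transpose_apply, hB,
      blockDiagonal'_toeplitz_apply, nilSum_pow_apply]
    simp only [f, g, Fin.mk.injEq]
    split_ifs with h1 h2 h2
    · congr 2
      omega
    · omega
    · omega
    · rfl
  · intro y x hxy
    rw [Matrix.transpose_apply, hB, blockDiagonal'_toeplitz_apply] at hxy
    obtain ⟨n, i⟩ := x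
    obtain ⟨n', j⟩ := y
    by_cases hn : n = n'
    swap
    · exact absurd (if_neg hn) hxy
    subst hn
    rw [if_pos rfl] at hxy
    dsimp only at hxy
    have hnm := n.2
    have hi := i.2
    have hj := j.2
    have l1 : ¬ ((s : ℤ) - ((m - (n : ℕ) : ℕ) : ℤ) + ((i : ℕ) : ℤ) - ((j : ℕ) : ℤ) < 0) :=
      fun hlt => hxy (by rw [chooseInt_of_neg hlt, Int.cast_zero])
    have l2 : ¬ ((k : ℤ) < (s : ℤ) - ((m - (n : ℕ) : ℕ) : ℤ) + ((i : ℕ) : ℤ) - ((j : ℕ) : ℤ)) :=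
      fun hlt => hxy (by rw [chooseInt_of_lt hlt, Int.cast_zero])
    constructor
    · refine ⟨⟨(⟨n - 1 - j, by omega⟩, ⟨j, by omega⟩), by dsimp only; omega⟩, ?_⟩
      exact sigma_fin_ext (by simp only [f]; omega) rfl
    · refine ⟨⟨(⟨r - 1 - i, by omega⟩, ⟨s + n + i - m, by omega⟩), by dsimp only; omega⟩, ?_⟩
      exact sigma_fin_ext (by simp only [g]; omega) (by simp only [g]; omega)
  · intro q q' hqq
    rw [nilSum_pow_apply] at hqq
    have := q'.1.2
    have := q'.2.2
    by_cases h1 : (q.1 : ℕ) + q.2 + k = q'.1 + q'.2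
    · exact ⟨⟨⟨q, by omega⟩, rfl⟩, ⟨⟨q', by omega⟩, rfl⟩⟩
    · exact absurd (if_neg h1) hqq

theorem rank_kronecker_sub_one_pow {r s k m : ℕ} (h : k + m = r + s) :
    ((Matrix.kronecker (jordanBlock F r) (jordanBlock F s) - 1) ^ k).rank =
      ∑ n ∈ Finset.range (m + 1), (toeplitz F s k (m - n) n).rank := by
  rw [(similar_kronecker_sub_one F r s).rank_pow, rank_nilSum_pow h]

end Rank

/-! ### The Jordan normal form of a nilpotent matrix -/

section JordanForm

open Polynomial

variable {F : Type*} [Field F]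

/-- The basis `X^(k-1), ..., X, 1` of `F[X] / (X^k)`. -/
theorem exists_basis_quotient_X_pow (k : ℕ) :
    ∃ b : Module.Basis (Fin k) F (F[X] ⧸ Submodule.span F[X] {(X : F[X]) ^ k}), ∀ a : Fin k,
      b a = Submodule.Quotient.mk (X ^ (k - 1 - (a : ℕ))) := by
  let pb := AdjoinRoot.powerBasis' (monic_X_pow (R := F) k)
  have hdim : pb.dim = k := by
    rw [AdjoinRoot.powerBasis'_dim, natDegree_X_pow]
  let b : Module.Basis (Fin k) F (AdjoinRoot ((X : F[X]) ^ k)) :=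
    pb.basis.reindex ((finCongr hdim).trans Fin.revPerm)
  have hb : ∀ a, b a = AdjoinRoot.mk _ (X ^ (k - 1 - (a : ℕ))) := by
    intro a
    simp only [b, Module.Basis.reindex_apply, PowerBasis.coe_basis, pb,
      AdjoinRoot.powerBasis'_gen, map_pow, AdjoinRoot.mk_X]
    congr 1
    simp
    omega
  exact ⟨b, hb⟩

/-- A nilpotent endomorphism has a Jordan basis. -/
theorem exists_jordan_basis {V : Type*} [AddCommGroup V] [Module F V] [FiniteDimensional F V]
    {f : Module.End F V} (hf : IsNilpotent f) :
    ∃ (d : ℕ) (k : Fin d → ℕ) (b : Module.Basis (Σ i, Fin (k i)) F V),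
      ∀ (i : Fin d) (a : Fin (k i)), f (b ⟨i, a⟩) =
        if h : (a : ℕ) = 0 then 0 else b ⟨i, ⟨a - 1, by omega⟩⟩ := by
  obtain ⟨N, hN⟩ := hf
  have htor : Module.IsTorsion' (Module.AEval' f) (Submonoid.powers (X : F[X])) := by
    intro x
    refine ⟨⟨X ^ N, N, rfl⟩, ?_⟩
    obtain ⟨v, rfl⟩ := (Module.AEval'.of f).surjective x
    change (X : F[X]) ^ N • Module.AEval'.of f v = 0
    rw [Module.AEval'.X_pow_smul_of, hN]
    simp
  obtain ⟨d, k, ⟨e⟩⟩ := Module.torsion_by_prime_power_decomposition (irreducible_X (R := F)) htor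
  choose c hc using fun i => exists_basis_quotient_X_pow (F := F) (k i)
  let e' := e.trans (DirectSum.linearEquivFunOnFintype F[X] (Fin d)
    fun i => F[X] ⧸ Submodule.span F[X] {(X : F[X]) ^ k i})
  let b : Module.Basis (Σ i, Fin (k i)) F V :=
    (Pi.basis c).map ((e'.restrictScalars F).symm.trans (Module.AEval'.of f).symm)
  have hb : ∀ x, e' (Module.AEval'.of f (b x)) = Pi.single x.1 (c x.1 x.2) := by
    intro x
    simp [b, Pi.basis_apply]
  refine ⟨d, k, b, fun i a => ?_⟩
  apply (Module.AEval'.of f).injective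
  apply e'.injective
  rw [← Module.AEval'.X_smul_of, map_smul, hb, ← Pi.single_smul, hc, ← Submodule.Quotient.mk_smul,
    smul_eq_mul, ← pow_succ']
  have ha := a.2
  split_ifs with h
  · rw [map_zero, map_zero, Pi.single_eq_zero_iff, Submodule.Quotient.mk_eq_zero,
      show k i - 1 - (a : ℕ) + 1 = k i by omega]
    exact Submodule.mem_span_singleton_self _
  · rw [hb, hc]
    congr 3
    dsimp only
    omega

theorem exists_similar_blockDiagonal_nilBlock {m : Type*} [Fintype m] [DecidableEq m]
    {N : Matrix m m F} (hN : IsNilpotent N) :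
    ∃ (d : ℕ) (k : Fin d → ℕ), Similar N (Matrix.blockDiagonal' fun i => nilBlock F (k i)) := by
  obtain ⟨d, k, b, hb⟩ := exists_jordan_basis (f := Matrix.toLin' N) (by
    obtain ⟨e, he⟩ := hN
    exact ⟨e, by rw [← Matrix.toLin'_pow, he, map_zero]⟩)
  have h1 := (Pi.basisFun F m).toMatrix_mul_toMatrix_flip b
  have h2 := b.toMatrix_mul_toMatrix_flip (Pi.basisFun F m)
  refine ⟨d, k, (Pi.basisFun F m).toMatrix b, b.toMatrix (Pi.basisFun F m), h1, h2, ?_⟩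
  suffices h : N * (Pi.basisFun F m).toMatrix b =
      (Pi.basisFun F m).toMatrix b * Matrix.blockDiagonal' fun i => nilBlock F (k i) by
    rw [← h, Matrix.mul_assoc, h1, Matrix.mul_one]
  ext x ⟨i, a⟩
  have e1 : (N * (Pi.basisFun F m).toMatrix b) x ⟨i, a⟩ = Matrix.toLin' N (b ⟨i, a⟩) x := by
    simp [Matrix.mul_apply, Matrix.mulVec, dotProduct, Module.Basis.toMatrix_apply]
  rw [e1, hb, Matrix.mul_apply, Fintype.sum_sigma, Finset.sum_eq_single i]
  · simp only [Matrix.blockDiagonal'_apply_eq, nilBlock_apply, Module.Basis.toMatrix_apply,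
      Pi.basisFun_repr]
    split_ifs with h
    · rw [Finset.sum_eq_zero]
      · rfl
      · intro j _
        rw [if_neg (by omega), mul_zero]
    · rw [Finset.sum_eq_single ⟨a - 1, by omega⟩]
      · rw [if_pos (by dsimp only; omega), mul_one]
      · intro j _ hj
        rw [if_neg fun e => hj (Fin.ext (by dsimp only; omega)), mul_zero]
      · simp
  · intro i' _ hi
    refine Finset.sum_eq_zero fun j _ => ?_
    rw [Matrix.blockDiagonal'_apply_ne _ _ _ hi, mul_zero]
  · simp

theorem Similar.trans {m n o : Type*} [Fintype m] [Fintype n] [Fintype o] [DecidableEq m]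
    [DecidableEq n] [DecidableEq o] {A : Matrix m m F} {B : Matrix n n F} {C : Matrix o o F}
    (h : Similar A B) (h' : Similar B C) : Similar A C := by
  obtain ⟨P, Q, h1, h2, h3⟩ := h
  obtain ⟨P', Q', h1', h2', h3'⟩ := h'
  refine ⟨P * P', Q' * Q, ?_, ?_, ?_⟩
  · calc P * P' * (Q' * Q) = P * (P' * Q') * Q := by simp only [Matrix.mul_assoc]
      _ = 1 := by rw [h1', Matrix.mul_one, h1]
  · calc Q' * Q * (P * P') = Q' * (Q * P) * P' := by simp only [Matrix.mul_assoc]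
      _ = 1 := by rw [h2, Matrix.mul_one, h2']
  · rw [h3, h3']
    simp only [Matrix.mul_assoc]

theorem similar_submatrix {m n : Type*} [Fintype m] [Fintype n] [DecidableEq m]
    [DecidableEq n] (A : Matrix m m F) (e : n ≃ m) : Similar A (A.submatrix e e) := by
  refine ⟨(1 : Matrix m m F).submatrix id e, (1 : Matrix m m F).submatrix e id, ?_, ?_, ?_⟩
  · rw [Matrix.submatrix_mul_equiv, Matrix.one_mul, Matrix.submatrix_id_id]
  · rw [← Matrix.submatrix_mul _ _ _ _ _ Function.bijective_id, Matrix.one_mul,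
      Matrix.submatrix_one_equiv]
  · rw [Matrix.submatrix_mul_equiv, Matrix.one_mul, Matrix.submatrix_mul_equiv, Matrix.mul_one,
      Matrix.submatrix_id_id]

/-- The values of a function with exactly `r` nonzero values, listed in decreasing order. -/
theorem exists_antitone_enumeration {ι : Type*} [Fintype ι] (k : ι → ℕ) {r : ℕ}
    (hr : (Finset.univ.filter fun i => 0 < k i).card = r) :
    ∃ e : Idx r → ι, Function.Injective e ∧ (∀ i, 0 < k i ↔ i ∈ Set.range e) ∧
      ∀ i j : Idx r, (i : ℕ) ≤ j → k (e j) ≤ k (e i) := by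
  have hcard : Fintype.card {i // 0 < k i} = r := by rw [Fintype.card_subtype, hr]
  let u := (Fintype.equivFinOfCardEq hcard).symm
  let σ := Tuple.sort fun a => k (u a)
  have hσ : Monotone ((fun a => k (u a)) ∘ σ) := Tuple.monotone_sort _
  have hlt : ∀ n : Idx r, r - (n : ℕ) < r := fun n => by
    have := Finset.mem_Icc.1 n.2
    omega
  refine ⟨fun n => (u (σ ⟨r - n, hlt n⟩) : ι), ?_, ?_, ?_⟩
  · intro a b hab
    have h1 := σ.injective (u.injective (Subtype.ext hab))
    have ha := Finset.mem_Icc.1 a.2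
    have hb := Finset.mem_Icc.1 b.2
    simp only [Fin.mk.injEq] at h1
    exact Subtype.ext (by omega)
  · intro i
    constructor
    · intro hi
      obtain ⟨x, hx⟩ := u.surjective ⟨i, hi⟩
      obtain ⟨y, rfl⟩ := σ.surjective x
      have hy := y.2
      refine ⟨⟨r - y, Finset.mem_Icc.2 (by omega)⟩, ?_⟩
      have : (⟨r - (r - (y : ℕ)), by omega⟩ : Fin r) = y := Fin.ext (by dsimp only; omega)
      dsimp only
      rw [this, hx]
    · rintro ⟨n, rfl⟩
      exact (u _).2
  · intro i j hij
    exact hσ (show (⟨r - j, hlt j⟩ : Fin r) ≤ ⟨r - i, hlt i⟩ from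
      Nat.sub_le_sub_left hij r)

theorem exists_similar_jordanSum {m : Type*} [Fintype m] [DecidableEq m] {N : Matrix m m F}
    (hN : IsNilpotent N) {r : ℕ} (hr : N.rank + r = Fintype.card m) :
    ∃ lam : Idx r → ℕ, (∀ i j : Idx r, (i : ℕ) ≤ j → lam j ≤ lam i) ∧ (∀ n, 0 < lam n) ∧
      Similar (1 + N) (jordanSum F lam) := by
  obtain ⟨d, k, hs⟩ := exists_similar_blockDiagonal_nilBlock hN
  have hrk : ∀ e, (N ^ e).rank = ∑ i, (k i - e) := by
    intro e
    rw [hs.rank_pow, ← Matrix.blockDiagonal'_pow, rank_blockDiagonal']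
    exact Finset.sum_congr rfl fun i _ => rank_nilBlock_pow _ _
  have h0 := hrk 0
  rw [pow_zero, Matrix.rank_one, sum_sub_eq_sum_sub_succ_add, ← hrk, zero_add, pow_one] at h0
  obtain ⟨e, he, he', hanti⟩ := exists_antitone_enumeration k (r := r) (by omega)
  refine ⟨fun n => k (e n), hanti, fun n => (he' _).2 ⟨n, rfl⟩, ?_⟩
  let g : (Σ n : Idx r, Fin (k (e n))) → Σ i, Fin (k i) := fun x => ⟨e x.1, x.2⟩
  have hg : Function.Bijective g := by
    constructor
    · rintro ⟨n, a⟩ ⟨n', a'⟩ h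
      simp only [g, Sigma.mk.injEq] at h
      obtain rfl := he h.1
      rw [eq_of_heq h.2]
    · rintro ⟨i, a⟩
      obtain ⟨n, rfl⟩ := (he' i).1 (Nat.pos_of_ne_zero fun h => by have := a.2; omega)
      exact ⟨⟨n, a⟩, rfl⟩
  have hsub : (Matrix.blockDiagonal' fun i => nilBlock F (k i)).submatrix (Equiv.ofBijective g hg)
      (Equiv.ofBijective g hg) = Matrix.blockDiagonal' fun n => nilBlock F (k (e n)) := by
    ext ⟨n, a⟩ ⟨n', a'⟩
    rw [Matrix.submatrix_apply, Equiv.ofBijective_apply, Equiv.ofBijective_apply]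
    by_cases h : n = n'
    · subst h
      rw [Matrix.blockDiagonal'_apply_eq, Matrix.blockDiagonal'_apply_eq]
    · rw [Matrix.blockDiagonal'_apply_ne _ _ _ h,
        Matrix.blockDiagonal'_apply_ne _ _ _ fun h' => h (he h')]
  rw [jordanSum_eq_one_add]
  refine (hs.trans ?_).add_one
  rw [← hsub]
  exact similar_submatrix _ _

end JordanForm

/-! ### The Jordan partition -/

theorem delta_eq_one_iff (r s p n : ℕ) (F : Type*) [Field F] [CharP F p] :
    delta r s p n = 1 ↔ (D r s n : F) ≠ 0 := by
  unfold delta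
  rw [Ne, CharP.intCast_eq_zero_iff F p, ← Int.modEq_zero_iff_dvd]
  split_ifs with h <;> simp [h]

theorem mem_nonvanishing {r s p n : ℕ} (hn : 1 ≤ n) (hn' : n < r) :
    n ∈ (nonvanishing r s p).1 ↔ delta r s p n = 1 := by
  simp only [nonvanishing, Finset.mem_filter, Finset.mem_Icc]
  exact ⟨fun h => h.2, fun h => ⟨by omega, h⟩⟩

theorem isNilpotent_kronecker_sub_one (F : Type*) [Field F] (r s : ℕ) :
    IsNilpotent (Matrix.kronecker (jordanBlock F r) (jordanBlock F s) - 1) := by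
  obtain ⟨P, Q, -, h2, h3⟩ := similar_kronecker_sub_one F r s
  have h0 : nilSum F r s ^ (r + s) = 0 := by
    ext q q'
    rw [nilSum_pow_apply, if_neg (by omega), Matrix.zero_apply]
  have e : ∀ k, P * nilSum F r s ^ k * Q * P = P * nilSum F r s ^ k := fun k => by
    rw [Matrix.mul_assoc, h2, Matrix.mul_one]
  refine ⟨r + s + 1, ?_⟩
  have hk : ∀ k, (P * nilSum F r s * Q) ^ (k + 1) = P * nilSum F r s ^ (k + 1) * Q := by
    intro k
    induction k with
    | zero => simp
    | succ k ih =>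
      rw [pow_succ, ih, ← Matrix.mul_assoc, ← Matrix.mul_assoc, e, pow_succ _ (k + 1),
        Matrix.mul_assoc P]
  rw [h3, hk, pow_succ, h0, zero_mul, Matrix.mul_zero, Matrix.zero_mul]

theorem exists_isJordanPartition (F : Type*) [Field F] {r s : ℕ} (hr : 1 ≤ r) (hrs : r ≤ s) :
    ∃ lam : Idx r → ℕ, IsJordanPartition F r s lam := by
  obtain ⟨a, ha, hstep, -, har, hsum⟩ := exists_walk F hrs
  have hrk := rank_kronecker_sub_one_pow (F := F) (r := r) (s := s) (k := 1) (m := r + s - 1)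
    (by omega)
  have hm := hsum (r + s - 1) (by omega)
  rw [show r + s - (r + s - 1) = 1 by omega] at hm
  rw [pow_one, hm] at hrk
  -- the rank is `r * (s - 1)`: the power `0` gives `a (r + s) = r`, and one step before, `a` is `r`
  -- if `r < s` and `r - 1` if `r = s`
  have hval : a (r + s - 1) * (r + s - 1 - a (r + s - 1)) + r = r * s := by
    have hfull := hsum (r + s) le_rfl
    rw [← rank_kronecker_sub_one_pow (r := r) (by omega), Nat.sub_self, pow_zero, Matrix.rank_one,
      Fintype.card_prod, Fintype.card_fin, Fintype.card_fin] at hfull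
    have h1 := ha (r + s) le_rfl
    have h2 := hstep (r + s - 1) (by omega)
    have h3 := ha (r + s - 1) (by omega)
    rw [Nat.sub_add_cancel (by omega)] at h2
    have h4 : a (r + s) = r := by
      obtain ⟨b, hb⟩ := Nat.exists_eq_add_of_le (show a (r + s) ≤ r + s by omega)
      rw [show r + s - a (r + s) = b by omega] at hfull
      have : ((a (r + s) : ℤ) - r) * (a (r + s) - s) = 0 := by
        have e1 : (a (r + s) : ℤ) + b = r + s := by exact_mod_cast hb.symm
        have e2 : (r : ℤ) * s = a (r + s) * b := by exact_mod_cast hfull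
        have e3 : (b : ℤ) = r + s - a (r + s) := by omega
        rw [e3] at e2
        linear_combination e2
      rcases mul_eq_zero.1 this with h | h
      · omega
      · omega
    rcases hrs.lt_or_eq with hlt | rfl
    · have h5 : ∀ d, 2 * r + d ≤ r + s → r ≤ a (2 * r + d) := by
        intro d
        induction d with
        | zero => intro _; exact har.ge
        | succ d ih => intro hd; exact (ih (by omega)).trans (hstep _ (by omega)).1
      have h6 := h5 (s - 1 - r) (by omega)
      rw [show 2 * r + (s - 1 - r) = r + s - 1 by omega] at h6
      rw [show a (r + s - 1) = r by omega, show r + s - 1 - r = s - 1 by omega, ← Nat.mul_succ]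
      congr 1
      omega
    · rw [show a (r + r - 1) = r - 1 by omega, show r + r - 1 - (r - 1) = r by omega,
        ← Nat.succ_mul]
      congr 1
      omega
  obtain ⟨lam, h1, h2, h3⟩ := exists_similar_jordanSum (isNilpotent_kronecker_sub_one F r s)
    (r := r) (by rw [hrk, hval, Fintype.card_prod, Fintype.card_fin, Fintype.card_fin])
  rw [add_sub_cancel] at h3
  exact ⟨lam, h1, h2, h3⟩

theorem IsJordanPartition.rank_pow {F : Type*} [Field F] {r s : ℕ} {lam : Idx r → ℕ}
    (h : IsJordanPartition F r s lam) (k : ℕ) :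
    ((Matrix.kronecker (jordanBlock F r) (jordanBlock F s) - 1) ^ k).rank =
      ∑ n, (lam n - k) := by
  rw [← rank_jordanSum_sub_one_pow (F := F), h.2.2.sub_one.rank_pow]

/-- The parts of the Jordan partition are constant on the gaps of the set of all `n` with
`D_n ≢ 0`. -/
theorem IsJordanPartition.add_add_eq {F : Type*} [Field F] {p : ℕ} [CharP F p] {r s : ℕ}
    (hrs : r ≤ s) {lam : Idx r → ℕ} (h : IsJordanPartition F r s lam) {t t' : ℕ}
    (hg : IsGap r (nonvanishing r s p).1 t t') (n : Idx r) (hn : t < n) (hn' : (n : ℕ) ≤ t') :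
    lam n + t + t' = r + s := by
  obtain ⟨a, ha, hstep, hD, har, hsum⟩ := exists_walk F hrs
  have hle := hg.le (nonvanishing r s p).2
  have hmem : ∀ u, u ∈ (nonvanishing r s p).1 → a (2 * u) = u := by
    intro u hu
    have hu' := Finset.mem_Icc.1 ((nonvanishing r s p).2 hu)
    rw [hD u (by omega), ← delta_eq_one_iff r s p u F]
    exact (mem_nonvanishing (by omega) (by omega)).1 hu
  refine part_eq_of_walk (by omega) ha hstep h.1 (fun m hm => ?_) hg.lt hle ?_ ?_ ?_ n hn hn'
  · rw [← h.rank_pow, rank_kronecker_sub_one_pow (m := m) (by omega), hsum m hm]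
  · rcases hg.left with rfl | h1
    · have := ha 0 (Nat.zero_le _)
      simp only [mul_zero]
      omega
    · exact hmem t h1
  · rcases hg.right with rfl | h1
    · exact har
    · exact hmem t' h1
  · intro u h1 h2 h3
    rw [hD u (by omega), ← delta_eq_one_iff r s p u F] at h3
    have := hg.not_between u ((mem_nonvanishing (by omega) (by omega)).2 h3)
    omega

theorem delta_zero {r s p : ℕ} (hp : p.Prime) : delta r s p 0 = 1 := by
  have : Fact p.Prime := ⟨hp⟩
  rw [delta_eq_one_iff r s p 0 (ZMod p), D, Matrix.det_isEmpty]
  simp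

theorem delta_self {r s p : ℕ} (hp : p.Prime) (hrs : r ≤ s) : delta r s p r = 1 := by
  have : Fact p.Prime := ⟨hp⟩
  obtain ⟨a, -, -, hD, har, -⟩ := exists_walk (ZMod p) hrs
  rw [delta_eq_one_iff r s p r (ZMod p), ← hD r le_rfl]
  exact har

/-- `n - L(n)` and `n + R(n)` are the ends of the gap which contains `n`. -/
theorem L_R_of_isGap {r s p : ℕ} (hp : p.Prime) (hrs : r ≤ s) {t t' : ℕ}
    (hg : IsGap r (nonvanishing r s p).1 t t') {n : ℕ} (hn : t < n) (hn' : n ≤ t') :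
    L r s p n + t = n ∧ n + R r s p n = t' := by
  have hle := hg.le (nonvanishing r s p).2
  have hδ : ∀ u, t < u → u < t' → delta r s p u ≠ 1 := by
    intro u h1 h2 h3
    have := hg.not_between u ((mem_nonvanishing (by omega) (by omega)).2 h3)
    omega
  have hmem : ∀ u, u ∈ (nonvanishing r s p).1 → delta r s p u = 1 :=
    fun u hu => (Finset.mem_filter.1 hu).2
  have ht : delta r s p t = 1 := hg.left.elim (fun h => h ▸ delta_zero hp) (hmem t)
  have ht' : delta r s p t' = 1 := hg.right.elim (fun h => by rw [h]; exact delta_self hp hrs) (hmem t')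
  constructor
  · have h1 : n - t ∈ {l | 0 < l ∧ l ≤ n ∧ delta r s p (n - l) = 1} :=
      ⟨by omega, by omega, by rwa [show n - (n - t) = t by omega]⟩
    have h2 : L r s p n ≤ n - t := Nat.sInf_le h1
    have h3 : 0 < L r s p n ∧ L r s p n ≤ n ∧ delta r s p (n - L r s p n) = 1 :=
      Nat.sInf_mem ⟨_, h1⟩
    by_contra hne
    exact hδ (n - L r s p n) (by omega) (by omega) h3.2.2
  · have h1 : t' - n ∈ {k | n + k ≤ r ∧ delta r s p (n + k) = 1} :=
      ⟨by omega, by rwa [show n + (t' - n) = t' by omega]⟩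
    have h2 : R r s p n ≤ t' - n := Nat.sInf_le h1
    have h3 : n + R r s p n ≤ r ∧ delta r s p (n + R r s p n) = 1 := Nat.sInf_mem ⟨_, h1⟩
    by_contra hne
    exact hδ (n + R r s p n) (by omega) (by omega) h3.2

end Norman

theorem mainTheorem3 (r s p : ℕ) (hr : 1 ≤ r) (hrs : r ≤ s) (hp : p.Prime)
    (F : Type*) [Field F] [CharP F p] :
    (∃! lam : Norman.Idx r → ℕ, Norman.IsJordanPartition F r s lam) ∧
    ∀ lam : Norman.Idx r → ℕ, Norman.IsJordanPartition F r s lam →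
      (∃ (hbij : Function.Bijective (Norman.descents : Norman.Tuples r → Norman.Subsets r))
          (hdev : Norman.IsDeviationTuple (Norman.deviation s lam)),
        (⟨Norman.deviation s lam, hdev⟩ : Norman.Tuples r) =
          (Equiv.ofBijective Norman.descents hbij).symm (Norman.nonvanishing r s p)) ∧
      (∃ hN : Norman.IsNormanPartition s lam,
        Norman.normanPerm hN = Norman.permOfSubset (Norman.nonvanishing r s p) ∧
        ∀ n : Norman.Idx r, (((Norman.normanPerm hN n : Norman.Idx r) : ℕ) : ℤ) =
          ((n : ℕ) : ℤ) + 1 - (Norman.L r s p n : ℤ) + (Norman.R r s p n : ℤ)) ∧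
      (∀ n : Norman.Idx r, (lam n : ℤ) =
        (r : ℤ) + (s : ℤ) - 2 * ((n : ℕ) : ℤ) + (Norman.L r s p n : ℤ)
          - (Norman.R r s p n : ℤ)) := by
  have hgap : ∀ n : Norman.Idx r, ∃ t t', Norman.IsGap r (Norman.nonvanishing r s p).1 t t' ∧
      t < n ∧ (n : ℕ) ≤ t' := fun n =>
    Norman.exists_isGap (Finset.mem_Icc.1 n.2).1 (Finset.mem_Icc.1 n.2).2
  refine ⟨?_, fun lam hlam => ?_⟩
  · obtain ⟨lam, hlam⟩ := Norman.exists_isJordanPartition F hr hrs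
    refine ⟨lam, hlam, fun lam' hlam' => funext fun n => ?_⟩
    obtain ⟨t, t', hg, h1, h2⟩ := hgap n
    have e1 := hlam.add_add_eq hrs hg n h1 h2
    have e2 := hlam'.add_add_eq hrs hg n h1 h2
    omega
  have hdesc : ∀ (n : Norman.Idx r) (t t' : ℕ),
      Norman.IsGap r (Norman.nonvanishing r s p).1 t t' → t < n → (n : ℕ) ≤ t' →
        Norman.deviation s lam n = (r : ℤ) - t - t' := by
    intro n t t' hg h1 h2
    have := hlam.add_add_eq hrs hg n h1 h2
    unfold Norman.deviation
    omega
  have hdev := Norman.isDeviationTuple_of_isGap _ hdesc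
  have hsum : ∑ n, lam n = r * s := by
    have := hlam.rank_pow 0
    rw [pow_zero, Matrix.rank_one, Fintype.card_prod, Fintype.card_fin, Fintype.card_fin] at this
    simpa using this.symm
  have hN : Norman.IsNormanPartition s lam :=
    { anti := hlam.1
      pos := hlam.2.1
      sum_eq := hsum
      sub_ne := fun i j hij => by
        have := hdev.2.1 i j hij
        unfold Norman.deviation at this
        omega
      bounds := hdev.2.2 }
  refine ⟨⟨Norman.descents_bijective r, hdev, ?_⟩, ⟨hN, ?_, fun n => ?_⟩, fun n => ?_⟩
  · rw [Equiv.eq_symm_apply]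
    exact Norman.descents_of_isGap _ _ hdesc
  · ext n
    obtain ⟨t, t', hg, h1, h2⟩ := hgap n
    have e1 := hlam.add_add_eq hrs hg n h1 h2
    have e2 := Norman.permOfSubset_apply_of_isGap hr _ hg n h1 h2
    have e3 : ((Norman.normanPerm hN n : ℕ) : ℤ) = _ := Norman.coe_normanFun hN n
    have := hg.le (Norman.nonvanishing r s p).2
    omega
  · obtain ⟨t, t', hg, h1, h2⟩ := hgap n
    have e1 := hlam.add_add_eq hrs hg n h1 h2
    have e2 := Norman.L_R_of_isGap hp hrs hg h1 h2
    have e3 : ((Norman.normanPerm hN n : ℕ) : ℤ) = _ := Norman.coe_normanFun hN n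
    omega
  · obtain ⟨t, t', hg, h1, h2⟩ := hgap n
    have e1 := hlam.add_add_eq hrs hg n h1 h2
    have e2 := Norman.L_R_of_isGap hp hrs hg h1 h2
    omega
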